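/- For an integer $M\ge 1$, let $\mu_M$ be the critical three-colour mean-field Potts distribution on $\{1,2,3\}^M$, \[\mu_M(\sigma)\propto \exp\Big(M\tilde\beta_c\big(s_1(\sigma)^2+s_2(\sigma)^2+s_3(\sigma)^2\big)\Big),\qquad \tilde\beta_c:=2\log 2,\] where $s_k(\sigma)$ is the proportion of spins of colour $k$ in $\sigma$. Let $\sigma(0),\sigma(1),\ldots$ be the Glauber dynamics for $\mu_M$ (in each step a uniformly chosen spin is resampled from its conditional distribution under $\mu_M$ given the other spins), and let $S(t):=(s_1(\sigma(t)),s_2(\sigma(t)),s_3(\sigma(t)))$ be the magnetisation chain, whose state space $\Omega^S$ is the set of all possible vectors $(s_1(\sigma),s_2(\sigma),s_3(\sigma))$. For $s,s'\in\mathbb{R}^3$ put $d(s,s'):=\frac{1}{\sqrt 2}\big(\sum_{k=1}^3(s_k-s_k')^2\big)^{1/2}$, let \[C_1:=\left(\tfrac23,\tfrac16,\tfrac16\right),\quad C_2:=\left(\tfrac16,\tfrac23,\tfrac16\right),\quad C_3:=\left(\tfrac16,\tfrac16,\tfrac23\right),\quad C_4:=\left(\tfrac13,\tfrac13,\tfrac13\right),\]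 $d_C(s):=\min_{1\le i\le 4}d(s,C_i)$ and $\rho:=10^{-6}$, and let \[\tau:=\inf\{k\ge 0:\ d_C(S(k))\le \rho/2\}\in\{0,1,2,\ldots\}\cup\{\infty\}.\] \textbf{Proposition (Time to get to a central region).} There is an absolute constant $C>0$ such that for every $M$ for which at least one $z\in\Omega^S$ satisfies $d_C(z)\le\rho/2$ (in particular for every $M\ge 10^7$), every initial position $s\in\Omega^S$ and every real $r\ge 0$, \[\mathbb{P}\big(\tau> r\cdot C M\log(M)\,\big|\,S(0)=s\big)\le \exp(-\lfloor r\rfloor).\] -/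

import Mathlib

open MeasureTheory ProbabilityTheory

noncomputable section

namespace MeanFieldPotts

/-- Spin configurations of `M` spins with three colours; colours `1, 2, 3` are `0, 1, 2 : Fin 3`. -/
abbrev Config (M : ℕ) : Type := Fin M → Fin 3

/-- The magnetisation vector `(s₁(σ), s₂(σ), s₃(σ))`: the proportion of spins of each colour. -/
def magnetisation {M : ℕ} (σ : Config M) : Fin 3 → ℝ :=
  fun k => ((Finset.univ.filter fun l => σ l = k).card : ℝ) / M

/-- The state space `Ω^S` of the magnetisation chain. -/
def magStates (M : ℕ) : Set (Fin 3 → ℝ) := Set.range (magnetisation (M := M))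

/-- The critical inverse temperature of the three-colour mean-field model. -/
def betaCrit : ℝ := 2 * Real.log 2

/-- Unnormalised Gibbs weight of a configuration. -/
def gibbsWeight (M : ℕ) (β : ℝ) (σ : Config M) : ℝ :=
  Real.exp (M * β * ∑ k, magnetisation σ k ^ 2)

/-- The mean-field Potts (Gibbs) distribution on configurations, as a probability mass function. -/
def gibbs (M : ℕ) (β : ℝ) (σ : Config M) : ℝ :=
  gibbsWeight M β σ / ∑ σ', gibbsWeight M β σ'

/-- Under the Gibbs distribution, the conditional probability that spin `l` has colour `c`
given that all other spins are as in `σ`. -/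
def spinCondProb (M : ℕ) (β : ℝ) (σ : Config M) (l : Fin M) (c : Fin 3) : ℝ :=
  gibbs M β (Function.update σ l c) / ∑ c', gibbs M β (Function.update σ l c')

/-- Transition probabilities of the Glauber dynamics: a uniformly chosen spin is resampled
from its conditional distribution given the other spins. -/
def glauber (M : ℕ) (β : ℝ) (σ σ' : Config M) : ℝ :=
  ∑ l, (1 / (M : ℝ)) *
    ∑ c, if Function.update σ l c = σ' then spinCondProb M β σ l c else 0

/-- `X` is a time-homogeneous Markov chain on the countable discrete space `E` with transition
probabilities `P` and arbitrary initial law, on the probability space `(Ω, μ)`. -/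
structure IsMarkovChain {Ω E : Type*} [MeasurableSpace Ω] [MeasurableSpace E]
    (μ : Measure Ω) (P : E → E → ℝ) (X : ℕ → Ω → E) : Prop where
  measurable : ∀ n, Measurable (X n)
  markov : ∀ (n : ℕ) (x : ℕ → E),
    μ.real {ω | ∀ k ≤ n + 1, X k ω = x k} =
      μ.real {ω | ∀ k ≤ n, X k ω = x k} * P (x n) (x (n + 1))

/-- Distance on the main triangle: the Euclidean distance in barycentric coordinates with respect
to an equilateral triangle of side length one. -/
def triDist (s s' : Fin 3 → ℝ) : ℝ :=
  1 / √2 * √(∑ k, (s k - s' k) ^ 2)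

/-- The four centres `C₁, C₂, C₃, C₄`. -/
def centre : Fin 4 → Fin 3 → ℝ :=
  ![![2 / 3, 1 / 6, 1 / 6], ![1 / 6, 2 / 3, 1 / 6], ![1 / 6, 1 / 6, 2 / 3], ![1 / 3, 1 / 3, 1 / 3]]

/-- Distance to the closest of the four centres. -/
def centreDist (s : Fin 3 → ℝ) : ℝ :=
  min (min (triDist s (centre 0)) (triDist s (centre 1)))
    (min (triDist s (centre 2)) (triDist s (centre 3)))

/-- The constant `ρ = 10⁻⁶`. -/
def rho : ℝ := 1 / 10 ^ 6

/-- The first time that a trajectory `S` in the main triangle is within `ρ / 2` of one of the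
centres; it is `⊤` if this never happens. -/
def hitTime (S : ℕ → Fin 3 → ℝ) : ℕ∞ :=
  ⨅ (k : ℕ) (_ : centreDist (S k) ≤ rho / 2), (k : ℕ∞)

end MeanFieldPotts

end

/-!
Up to errors of order `1 / M`, the magnetisation performs steps of size `1 / M` whose mean is the
drift `softmax (2 βc s) - s`, a negative multiple of the gradient of the mean-field free energy `F`.
At criticality the drift vanishes exactly at the four centres and at the permutations of `(1/2, 1/4,
1/4)`, the saddles of `F`. Away from the centres `F` therefore decreases on average by about
`|drift|² / M` per step, which is useless only near the saddles. There one coordinate is unstable,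
and the noise of the dynamics does not degenerate, so that adding to `F` a multiple of a small bump,
concave in this coordinate at the saddles, gives a function `h` with
`E[Δh] ≤ -c (|drift|² / M + 1 / M²)` outside the central region.

Normalised to vanish at the saddles, `h` has size at most a multiple of `|drift|²`, because the
saddles are nondegenerate. Hence `V = M arsinh (M h / K)` decreases on average by a constant: where
`|h|` is at most of order `1 / M` the second term does this, and elsewhere the first one, since
`arsinh` then behaves like a signed logarithm. As `V` has size `M log M`, the expected hitting time
is `O(M log M)` from every initial position, and the Markov property turns this into an exponential
tail. For each of the finitely many remaining `M` any bound on the expected hitting time suffices.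
-/

noncomputable section

namespace MeanFieldPotts

/-! ### Finite Markov chains -/

section MarkovChain

variable {Ω E : Type*} [MeasurableSpace Ω]

theorem measureReal_eq_sum_inter_fibre [Fintype E] [MeasurableSpace E]
    [MeasurableSingletonClass E] {μ : Measure Ω} [IsFiniteMeasure μ] {f : Ω → E}
    (hf : Measurable f) (S : Set Ω) :
    μ.real S = ∑ x, μ.real (S ∩ {ω | f ω = x}) := by
  have h := sum_measureReal_preimage_singleton (μ := μ.restrict S) Finset.univ
    fun x _ => hf (measurableSet_singleton x)
  simp only [Finset.coe_univ, Set.preimage_univ, measureReal_restrict_apply_univ] at h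
  rw [← h]
  refine Finset.sum_congr rfl fun x _ => ?_
  rw [measureReal_restrict_apply (hf (measurableSet_singleton x)), Set.inter_comm]
  rfl

/-- The mass that a process `X` still carries at the point `x` at time `n` when it is killed on
entering `A`. -/
def survivalMass (μ : Measure Ω) (X : ℕ → Ω → E) (A : Set E) (n : ℕ) (x : E) : ℝ :=
  μ.real {ω | (∀ k ≤ n, X k ω ∉ A) ∧ X n ω = x}

theorem survivalMass_nonneg (μ : Measure Ω) (X : ℕ → Ω → E) (A : Set E) (n : ℕ) (x : E) :
    0 ≤ survivalMass μ X A n x :=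
  measureReal_nonneg

theorem survivalMass_of_mem (μ : Measure Ω) (X : ℕ → Ω → E) {A : Set E} (n : ℕ) {x : E}
    (hx : x ∈ A) : survivalMass μ X A n x = 0 := by
  have hempty : {ω | (∀ k ≤ n, X k ω ∉ A) ∧ X n ω = x} = ∅ :=
    Set.eq_empty_of_forall_notMem fun ω ⟨hA, hω⟩ => hA n le_rfl (hω ▸ hx)
  rw [survivalMass, hempty, measureReal_empty]

namespace IsMarkovChain

variable [MeasurableSpace E] {μ : Measure Ω} {P : E → E → ℝ} {X : ℕ → Ω → E} {A : Set E}

theorem cond_initial (hX : IsMarkovChain μ P X) {I : Set E} (hI : MeasurableSet I) :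
    IsMarkovChain (μ[|X 0 ⁻¹' I]) P X where
  measurable := hX.measurable
  markov n x := by
    have hmeas : MeasurableSet (X 0 ⁻¹' I) := hX.measurable 0 hI
    simp only [measureReal_def, cond_apply hmeas, ENNReal.toReal_mul]
    simp only [← measureReal_def]
    by_cases hx : x 0 ∈ I
    · have hsub (m : ℕ) : X 0 ⁻¹' I ∩ {ω | ∀ k ≤ m, X k ω = x k} = {ω | ∀ k ≤ m, X k ω = x k} :=
        Set.inter_eq_right.2 fun ω hω => by simpa only [Set.mem_preimage, hω 0 m.zero_le] using hx
      rw [hsub, hsub, hX.markov, mul_assoc]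
    · have hempty (m : ℕ) : X 0 ⁻¹' I ∩ {ω | ∀ k ≤ m, X k ω = x k} = ∅ :=
        Set.eq_empty_of_forall_notMem fun ω ⟨hω, hpath⟩ => hx (hpath 0 m.zero_le ▸ hω)
      simp only [hempty, measureReal_empty, mul_zero, zero_mul]

theorem measureReal_path_eq_inter_next (hX : IsMarkovChain μ P X) {n : ℕ} (a : Fin (n + 1) → E)
    (y : E) :
    μ.real ({ω | (fun k : Fin (n + 1) => X k ω) = a} ∩ {ω | X (n + 1) ω = y}) =
      μ.real {ω | (fun k : Fin (n + 1) => X k ω) = a} * P (a (Fin.last n)) y := by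
  obtain ⟨x, hx, hxy⟩ : ∃ x : ℕ → E, (∀ k : Fin (n + 1), x k = a k) ∧ x (n + 1) = y :=
    ⟨fun k => if h : k < n + 1 then a ⟨k, h⟩ else y, fun k => dif_pos k.2, dif_neg (lt_irrefl _)⟩
  have hpath : {ω | (fun k : Fin (n + 1) => X k ω) = a} = {ω | ∀ k ≤ n, X k ω = x k} := by
    ext ω
    simp only [Set.mem_ofPred_eq, funext_iff, ← hx, Fin.forall_iff, Nat.lt_succ_iff]
  have hnext : {ω | ∀ k ≤ n, X k ω = x k} ∩ {ω | X (n + 1) ω = y} =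
      {ω | ∀ k ≤ n + 1, X k ω = x k} := by
    ext ω
    simp only [Set.mem_inter_iff, Set.mem_ofPred_eq, Nat.le_succ_iff, or_imp, forall_and,
      forall_eq, hxy]
  rw [hpath, hnext, hX.markov, hxy, ← hx, Fin.val_last]

variable [MeasurableSingletonClass E] [IsFiniteMeasure μ]

theorem measureReal_path_mem_inter_next [Finite E] (hX : IsMarkovChain μ P X) {n : ℕ}
    {B : Set (Fin (n + 1) → E)} {x : E} (hB : ∀ a ∈ B, a (Fin.last n) = x) (y : E) :
    μ.real ({ω | (fun k : Fin (n + 1) => X k ω) ∈ B} ∩ {ω | X (n + 1) ω = y}) =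
      μ.real {ω | (fun k : Fin (n + 1) => X k ω) ∈ B} * P x y := by
  have := Fintype.ofFinite E
  have hpath : Measurable fun ω (k : Fin (n + 1)) => X k ω :=
    measurable_pi_lambda _ fun k => hX.measurable k
  rw [measureReal_eq_sum_inter_fibre hpath, measureReal_eq_sum_inter_fibre hpath
    {ω | (fun k : Fin (n + 1) => X k ω) ∈ B}, Finset.sum_mul]
  refine Finset.sum_congr rfl fun a _ => ?_
  rw [Set.inter_right_comm]
  by_cases ha : a ∈ B
  · have hfibre : {ω | (fun k : Fin (n + 1) => X k ω) ∈ B} ∩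
        {ω | (fun k : Fin (n + 1) => X k ω) = a} = {ω | (fun k : Fin (n + 1) => X k ω) = a} :=
      Set.inter_eq_right.2 fun ω hω => by rwa [Set.mem_ofPred_eq, hω]
    rw [hfibre, hX.measureReal_path_eq_inter_next, hB a ha]
  · have hempty : {ω | (fun k : Fin (n + 1) => X k ω) ∈ B} ∩
        {ω | (fun k : Fin (n + 1) => X k ω) = a} = ∅ :=
      Set.eq_empty_of_forall_notMem fun ω ⟨hω, hωa⟩ => ha (hωa ▸ hω)
    rw [hempty, Set.empty_inter, measureReal_empty, zero_mul]

variable [Fintype E]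

theorem survivalMass_succ_le (hX : IsMarkovChain μ P X) (n : ℕ) (y : E) :
    survivalMass μ X A (n + 1) y ≤ ∑ x, survivalMass μ X A n x * P x y := by
  rw [survivalMass, measureReal_eq_sum_inter_fibre (hX.measurable n)]
  refine Finset.sum_le_sum fun x _ => ?_
  have hstep := hX.measureReal_path_mem_inter_next (n := n) (x := x)
    (B := {a | (∀ k, a k ∉ A) ∧ a (Fin.last n) = x}) (fun a ha => ha.2) y
  simp only [Set.mem_ofPred_eq, Fin.forall_iff, Nat.lt_succ_iff, Fin.val_last] at hstep
  rw [survivalMass, ← hstep]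
  exact measureReal_mono fun ω ⟨⟨hA, hy⟩, hx⟩ => ⟨⟨fun k hk => hA k (Nat.le_succ_of_le hk), hx⟩, hy⟩

theorem sum_survivalMass (hX : IsMarkovChain μ P X) (n : ℕ) :
    ∑ x, survivalMass μ X A n x = μ.real {ω | ∀ k ≤ n, X k ω ∉ A} :=
  (measureReal_eq_sum_inter_fibre (hX.measurable n) _).symm

section Lyapunov

variable {V : E → ℝ} (hX : IsMarkovChain μ P X)
include hX

theorem sum_survivalMass_succ_mul_le (hV0 : ∀ x, 0 ≤ V x)
    (hV : ∀ x ∉ A, ∑ y, P x y * V y ≤ V x - 1) (n : ℕ) :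
    ∑ y, survivalMass μ X A (n + 1) y * V y ≤
      ∑ x, survivalMass μ X A n x * V x - μ.real {ω | ∀ k ≤ n, X k ω ∉ A} := by
  rw [← hX.sum_survivalMass, ← Finset.sum_sub_distrib]
  calc ∑ y, survivalMass μ X A (n + 1) y * V y
      ≤ ∑ y, (∑ x, survivalMass μ X A n x * P x y) * V y :=
        Finset.sum_le_sum fun y _ =>
          mul_le_mul_of_nonneg_right (hX.survivalMass_succ_le n y) (hV0 y)
    _ = ∑ x, survivalMass μ X A n x * ∑ y, P x y * V y := by
        simp_rw [Finset.sum_mul, Finset.mul_sum, mul_assoc]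
        exact Finset.sum_comm
    _ ≤ ∑ x, (survivalMass μ X A n x * V x - survivalMass μ X A n x) := by
        refine Finset.sum_le_sum fun x _ => ?_
        by_cases hx : x ∈ A
        · simp only [survivalMass_of_mem μ X n hx, zero_mul, sub_zero, le_refl]
        · rw [← mul_sub_one]
          exact mul_le_mul_of_nonneg_left (hV x hx) (survivalMass_nonneg ..)

theorem mul_measureReal_avoid_add_le (hV0 : ∀ x, 0 ≤ V x)
    (hV : ∀ x ∉ A, ∑ y, P x y * V y ≤ V x - 1) {B : ℝ} (hB : ∀ x, V x ≤ B) (m T : ℕ) :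
    (T + 1) * μ.real {ω | ∀ k ≤ m + T, X k ω ∉ A} ≤ B * μ.real {ω | ∀ k ≤ m, X k ω ∉ A} := by
  set p := μ.real {ω | ∀ k ≤ m + T, X k ω ∉ A}
  have hdecay : ∀ N ≤ T + 1, N * p + ∑ x, survivalMass μ X A (m + N) x * V x ≤
      ∑ x, survivalMass μ X A m x * V x := by
    intro N
    induction N with
    | zero => simp
    | succ N ih =>
      intro hN
      have hmono : p ≤ μ.real {ω | ∀ k ≤ m + N, X k ω ∉ A} :=
        measureReal_mono fun ω hω k hk => hω k (by omega)
      have hstep := hX.sum_survivalMass_succ_mul_le (A := A) hV0 hV (m + N)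
      push_cast
      rw [← add_assoc]
      linarith [ih (by omega)]
  calc (T + 1) * p
      ≤ (T + 1 : ℕ) * p + ∑ x, survivalMass μ X A (m + (T + 1)) x * V x := by
        push_cast
        exact le_add_of_nonneg_right
          (Finset.sum_nonneg fun x _ => mul_nonneg (survivalMass_nonneg ..) (hV0 x))
    _ ≤ ∑ x, survivalMass μ X A m x * V x := hdecay (T + 1) le_rfl
    _ ≤ ∑ x, B * survivalMass μ X A m x := Finset.sum_le_sum fun x _ => by
        rw [mul_comm B]
        exact mul_le_mul_of_nonneg_left (hB x) (survivalMass_nonneg ..)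
    _ = B * μ.real {ω | ∀ k ≤ m, X k ω ∉ A} := by rw [← Finset.mul_sum, hX.sum_survivalMass]

theorem measureReal_avoid_le_exp [IsProbabilityMeasure μ] (hV0 : ∀ x, 0 ≤ V x)
    (hV : ∀ x ∉ A, ∑ y, P x y * V y ≤ V x - 1) {B : ℝ} (hB : ∀ x, V x ≤ B) {T : ℕ}
    (hT : Real.exp 1 * B ≤ T) (n : ℕ) :
    μ.real {ω | ∀ k ≤ n * T, X k ω ∉ A} ≤ Real.exp (-n) := by
  induction n with
  | zero => simp
  | succ n ih =>
    have hmul := hX.mul_measureReal_avoid_add_le hV0 hV hB (n * T) T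
    rw [← Nat.succ_mul] at hmul
    have hblock : Real.exp 1 * μ.real {ω | ∀ k ≤ (n + 1) * T, X k ω ∉ A} ≤
        μ.real {ω | ∀ k ≤ n * T, X k ω ∉ A} := by
      have hT1 : (0 : ℝ) < T + 1 := by positivity
      refine le_of_mul_le_mul_left ?_ hT1
      nlinarith [Real.exp_pos 1, (measureReal_nonneg : 0 ≤ μ.real {ω | ∀ k ≤ n * T, X k ω ∉ A})]
    rw [Nat.cast_succ, neg_add_rev, Real.exp_add, Real.exp_neg 1, ← div_eq_inv_mul,
      le_div_iff₀' (Real.exp_pos 1)]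
    exact hblock.trans ih

end Lyapunov

end IsMarkovChain

theorem exists_unit_drift_of_descent [Fintype E] {P : E → E → ℝ} (hP0 : ∀ x y, 0 ≤ P x y)
    (hP1 : ∀ x, ∑ y, P x y = 1) {A : Set E} (D : E → ℕ) {q : ℝ} (hq0 : 0 < q) (hq1 : q ≤ 1)
    (hD : ∀ x ∉ A, ∃ y, D y < D x ∧ q ≤ P x y) :
    ∃ V : E → ℝ, (∀ x, 0 ≤ V x) ∧ ∀ x ∉ A, ∑ y, P x y * V y ≤ V x - 1 := by
  set t := q / 2 with ht
  have ht0 : 0 < t := by positivity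
  have ht1 : t ≤ 1 := by linarith
  obtain ⟨N, hN⟩ : ∃ N, ∀ x, D x ≤ N := by
    obtain ⟨N, hN⟩ := (Set.finite_range D).bddAbove
    exact ⟨N, fun x => hN ⟨x, rfl⟩⟩
  have htN : 0 < t ^ N := pow_pos ht0 N
  refine ⟨fun x => (1 - t ^ D x) / t ^ N,
    fun x => div_nonneg (sub_nonneg.2 (pow_le_one₀ ht0.le ht1)) htN.le, fun x hx => ?_⟩
  obtain ⟨y, hyx, hqy⟩ := hD x hx
  have hdescent : 2 * t ^ D x ≤ ∑ z, P x z * t ^ D z :=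
    calc 2 * t ^ D x ≤ 2 * t ^ (D y + 1) :=
          mul_le_mul_of_nonneg_left (pow_le_pow_of_le_one ht0.le ht1 hyx) two_pos.le
      _ = q * t ^ D y := by rw [pow_succ, ht]; ring
      _ ≤ P x y * t ^ D y := mul_le_mul_of_nonneg_right hqy (pow_pos ht0 _).le
      _ ≤ ∑ z, P x z * t ^ D z := Finset.single_le_sum
          (f := fun z => P x z * t ^ D z)
          (fun z _ => mul_nonneg (hP0 x z) (pow_pos ht0 _).le) (Finset.mem_univ y)
  simp_rw [← mul_div_assoc, mul_one_sub]
  rw [← Finset.sum_div, Finset.sum_sub_distrib, hP1, le_sub_iff_add_le,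
    div_add_one htN.ne', div_le_div_iff_of_pos_right htN]
  linarith [pow_le_pow_of_le_one ht0.le ht1 (hN x)]

end MarkovChain

/-! ### The softmax map and its potential -/

section Softmax

variable {ι : Type*} [Fintype ι]

/-- The softmax map with slope `β`. The Glauber dynamics at inverse temperature `β / 2` resamples
a spin from (a small perturbation of) `softmax β s`, where `s` is the current magnetisation. -/
def softmax (β : ℝ) (s : ι → ℝ) (k : ι) : ℝ :=
  Real.exp (β * s k) / ∑ j, Real.exp (β * s j)

/-- The drift of the mean-field dynamics: the magnetisation `s` is attracted by `softmax β s`. -/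
def drift (β : ℝ) (s : ι → ℝ) (k : ι) : ℝ := softmax β s k - s k

/-- The squared Euclidean norm of the drift. -/
def driftSq (β : ℝ) (s : ι → ℝ) : ℝ := ∑ k, drift β s k ^ 2

/-- The mean-field free energy, whose gradient is `-β • drift β`. -/
def potential (β : ℝ) (s : ι → ℝ) : ℝ :=
  β / 2 * ∑ k, s k ^ 2 - Real.log (∑ k, Real.exp (β * s k))

theorem driftSq_nonneg (β : ℝ) (s : ι → ℝ) : 0 ≤ driftSq β s :=
  Finset.sum_nonneg fun _ _ => sq_nonneg _

theorem driftSq_eq_zero {β : ℝ} {s : ι → ℝ} : driftSq β s = 0 ↔ ∀ k, drift β s k = 0 := by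
  simp only [driftSq, Finset.sum_eq_zero_iff_of_nonneg fun k _ => sq_nonneg (drift β s k),
    Finset.mem_univ, true_implies, sq_eq_zero_iff]

theorem sq_drift_le_driftSq (β : ℝ) (s : ι → ℝ) (k : ι) : drift β s k ^ 2 ≤ driftSq β s :=
  Finset.single_le_sum (f := fun k => drift β s k ^ 2) (fun _ _ => sq_nonneg _)
    (Finset.mem_univ k)

theorem abs_drift_le_sqrt (β : ℝ) (s : ι → ℝ) (k : ι) : |drift β s k| ≤ √(driftSq β s) :=
  Real.abs_le_sqrt (sq_drift_le_driftSq β s k)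

/-- The derivative of `softmax β · k` at `s`. -/
def softmaxDeriv (β : ℝ) (s : ι → ℝ) (k : ι) : (ι → ℝ) →L[ℝ] ℝ :=
  (β * softmax β s k) • (ContinuousLinearMap.proj k -
    ∑ j, softmax β s j • ContinuousLinearMap.proj (R := ℝ) (φ := fun _ : ι => ℝ) j)

theorem softmaxDeriv_apply (β : ℝ) (s w : ι → ℝ) (k : ι) :
    softmaxDeriv β s k w = β * softmax β s k * (w k - ∑ j, softmax β s j * w j) := by
  simp only [softmaxDeriv, _root_.smul_apply, _root_.sub_apply, _root_.sum_apply,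
    ContinuousLinearMap.proj_apply, smul_eq_mul]

variable [Nonempty ι]

theorem sum_exp_pos (β : ℝ) (s : ι → ℝ) : 0 < ∑ j, Real.exp (β * s j) :=
  Finset.sum_pos (fun _ _ => Real.exp_pos _) Finset.univ_nonempty

theorem softmax_pos (β : ℝ) (s : ι → ℝ) (k : ι) : 0 < softmax β s k :=
  div_pos (Real.exp_pos _) (sum_exp_pos β s)

theorem sum_softmax (β : ℝ) (s : ι → ℝ) : ∑ k, softmax β s k = 1 := by
  simp only [softmax]
  rw [← Finset.sum_div, div_self (sum_exp_pos β s).ne']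

theorem softmax_mem_stdSimplex (β : ℝ) (s : ι → ℝ) : softmax β s ∈ stdSimplex ℝ ι :=
  ⟨fun k => (softmax_pos β s k).le, sum_softmax β s⟩

theorem exp_neg_div_card_le_softmax {β : ℝ} (hβ : 0 ≤ β) {s : ι → ℝ}
    (hs : ∀ k, s k ∈ Set.Icc 0 1) (k : ι) :
    Real.exp (-β) / Fintype.card ι ≤ softmax β s k := by
  have hnum : 1 ≤ Real.exp (β * s k) := Real.one_le_exp (mul_nonneg hβ (hs k).1)
  have hden : ∑ j, Real.exp (β * s j) ≤ Fintype.card ι * Real.exp β := by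
    rw [← nsmul_eq_mul]
    exact Finset.sum_le_card_nsmul _ _ _ fun j _ =>
      Real.exp_le_exp.2 (mul_le_of_le_one_right hβ (hs j).2)
  rw [Real.exp_neg, ← one_div, div_div, mul_comm]
  exact div_le_div₀ (Real.exp_pos _).le hnum (sum_exp_pos β s) hden

theorem softmax_eq_exp (β : ℝ) (s : ι → ℝ) (k : ι) :
    softmax β s k = Real.exp (β * s k - Real.log (∑ j, Real.exp (β * s j))) := by
  rw [Real.exp_sub, Real.exp_log (sum_exp_pos β s), softmax]

theorem log_softmax (β : ℝ) (s : ι → ℝ) (k : ι) :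
    Real.log (softmax β s k) = β * s k - Real.log (∑ j, Real.exp (β * s j)) := by
  rw [softmax_eq_exp, Real.log_exp]

theorem hasFDerivAt_softmax (β : ℝ) (s : ι → ℝ) (k : ι) :
    HasFDerivAt (fun s => softmax β s k) (softmaxDeriv β s k) s := by
  have hproj (j : ι) : HasFDerivAt (fun s : ι → ℝ => β * s j)
      (β • ContinuousLinearMap.proj (R := ℝ) (φ := fun _ : ι => ℝ) j) s :=
    (hasFDerivAt_apply j s).const_mul β
  have hlog := (HasFDerivAt.fun_sum (u := Finset.univ) fun j _ => (hproj j).exp).log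
    (sum_exp_pos β s).ne'
  have h := ((hproj k).fun_sub hlog).exp
  simp only [← softmax_eq_exp] at h
  refine h.congr_fderiv (ContinuousLinearMap.ext fun w => ?_)
  rw [softmaxDeriv_apply]
  simp only [_root_.smul_apply, _root_.sub_apply, _root_.sum_apply,
    ContinuousLinearMap.proj_apply, smul_eq_mul, softmax, Finset.mul_sum, mul_sub]
  refine congrArg₂ _ (by ring) (Finset.sum_congr rfl fun j _ => by ring)

theorem contDiff_softmax (β : ℝ) (k : ι) : ContDiff ℝ 1 fun s => softmax β s k :=
  ContDiff.div (by fun_prop) (by fun_prop) fun s => (sum_exp_pos β s).ne'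

theorem continuous_driftSq (β : ℝ) : Continuous (driftSq β : (ι → ℝ) → ℝ) :=
  continuous_finsetSum _ fun k _ =>
    ((contDiff_softmax β k).continuous.sub (continuous_apply k)).pow 2

theorem exists_abs_softmax_sub_le (β R : ℝ) : ∃ L > 0, ∀ s t : ι → ℝ, ‖s‖ ≤ R → ‖t‖ ≤ R →
    ∀ k, |softmax β s k - softmax β t k| ≤ L * ‖s - t‖ := by
  have h (k : ι) : ∃ K, LipschitzOnWith K (fun s => softmax β s k)
      (Metric.closedBall (0 : ι → ℝ) R) :=
    (contDiff_softmax β k).contDiffOn.exists_lipschitzOnWith one_ne_zero (convex_closedBall _ _)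
      (isCompact_closedBall _ _)
  choose K hK using h
  refine ⟨∑ k, (K k : ℝ) + 1, by positivity, fun s t hs ht k => ?_⟩
  have hst := (hK k).dist_le_mul s (mem_closedBall_zero_iff.2 hs) t (mem_closedBall_zero_iff.2 ht)
  rw [Real.dist_eq, dist_eq_norm] at hst
  refine hst.trans (mul_le_mul_of_nonneg_right ?_ (norm_nonneg _))
  exact (Finset.single_le_sum (f := fun k => (K k : ℝ)) (fun i _ => (K i).2)
    (Finset.mem_univ k)).trans (le_add_of_nonneg_right zero_le_one)

theorem exists_abs_drift_sub_le (β R : ℝ) : ∃ L > 0, ∀ s t : ι → ℝ, ‖s‖ ≤ R → ‖t‖ ≤ R →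
    ∀ k, |drift β s k - drift β t k| ≤ L * ‖s - t‖ := by
  obtain ⟨L, hL, hsoftmax⟩ := exists_abs_softmax_sub_le (ι := ι) β R
  refine ⟨L + 1, by positivity, fun s t hs ht k => ?_⟩
  calc |drift β s k - drift β t k|
      = |(softmax β s k - softmax β t k) - (s - t) k| := by
        simp only [drift, Pi.sub_apply]; congr 1; ring
    _ ≤ |softmax β s k - softmax β t k| + |(s - t) k| := abs_sub _ _
    _ ≤ L * ‖s - t‖ + ‖s - t‖ := add_le_add (hsoftmax s t hs ht k) (norm_le_pi_norm (s - t) k)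
    _ = (L + 1) * ‖s - t‖ := by ring

theorem exists_drift_expansion_of_fixed {β : ℝ} {p : ι → ℝ} (hp : softmax β p = p) {κ : ℝ}
    (hκ : 0 < κ) : ∃ r > 0, ∀ s, ‖s - p‖ ≤ r → ∀ k,
      |drift β s k - (β * p k * ((s - p) k - ∑ j, p j * (s - p) j) - (s - p) k)| ≤
        κ * ‖s - p‖ := by
  have hloc (k : ι) := (hasFDerivAt_softmax β p k).isLittleO.def hκ
  obtain ⟨r, hr, hball⟩ := Metric.nhds_basis_closedBall.eventually_iff.1
    (Filter.eventually_all.2 hloc)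
  refine ⟨r, hr, fun s hs k => le_of_eq_of_le ?_ (hball (mem_closedBall_iff_norm.2 hs) k)⟩
  rw [Real.norm_eq_abs, softmaxDeriv_apply, hp]
  simp only [drift, Pi.sub_apply]
  congr 1; ring

theorem potential_add_le (β : ℝ) (s w : ι → ℝ) :
    potential β (s + w) ≤
      potential β s - β * ∑ k, drift β s k * w k + β / 2 * ∑ k, w k ^ 2 := by
  have hJensen : Real.exp (∑ k, softmax β s k * (β * w k)) ≤
      ∑ k, softmax β s k * Real.exp (β * w k) :=
    convexOn_exp.map_sum_le (fun k _ => (softmax_pos β s k).le) (sum_softmax β s)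
      fun _ _ => Set.mem_univ _
  have hprod : ∑ k, Real.exp (β * (s + w) k) =
      (∑ k, Real.exp (β * s k)) * ∑ k, softmax β s k * Real.exp (β * w k) := by
    rw [Finset.mul_sum]
    refine Finset.sum_congr rfl fun k _ => ?_
    rw [Pi.add_apply, mul_add, Real.exp_add, softmax, ← mul_assoc,
      mul_div_cancel₀ _ (sum_exp_pos β s).ne']
  have hlog : Real.log (∑ k, Real.exp (β * s k)) + ∑ k, softmax β s k * (β * w k) ≤
      Real.log (∑ k, Real.exp (β * (s + w) k)) := by
    rw [hprod, Real.log_mul (sum_exp_pos β s).ne' ((Real.exp_pos _).trans_le hJensen).ne']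
    gcongr
    rwa [Real.le_log_iff_exp_le ((Real.exp_pos _).trans_le hJensen)]
  have hquad : β / 2 * ∑ k, (s + w) k ^ 2 - ∑ k, softmax β s k * (β * w k) =
      β / 2 * ∑ k, s k ^ 2 - β * ∑ k, drift β s k * w k + β / 2 * ∑ k, w k ^ 2 := by
    simp only [Finset.mul_sum, ← Finset.sum_sub_distrib, ← Finset.sum_add_distrib]
    exact Finset.sum_congr rfl fun k _ => by rw [Pi.add_apply, drift]; ring
  unfold potential
  linarith

theorem abs_drift_le_one {β : ℝ} {s : ι → ℝ} (hs : s ∈ stdSimplex ℝ ι) (k : ι) :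
    |drift β s k| ≤ 1 :=
  Real.dist_le_of_mem_Icc_01 (mem_Icc_of_mem_stdSimplex (softmax_mem_stdSimplex β s) k)
    (mem_Icc_of_mem_stdSimplex hs k)

theorem driftSq_le_card {β : ℝ} {s : ι → ℝ} (hs : s ∈ stdSimplex ℝ ι) :
    driftSq β s ≤ Fintype.card ι := by
  have h := Finset.sum_le_card_nsmul Finset.univ _ 1 fun k _ =>
    (sq_le_one_iff_abs_le_one _).2 (abs_drift_le_one (β := β) hs k)
  rwa [Finset.card_univ, nsmul_one] at h

theorem potential_sub_le {β : ℝ} (hβ : 0 ≤ β) {s t : ι → ℝ} {b : ℝ}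
    (hb : ∀ k, |drift β s k| ≤ b) :
    potential β t - potential β s ≤
      Fintype.card ι * β * (b * ‖t - s‖ + ‖t - s‖ ^ 2 / 2) := by
  have hcoord (k : ι) : |(t - s) k| ≤ ‖t - s‖ := norm_le_pi_norm (t - s) k
  have hlin : -(Fintype.card ι * (b * ‖t - s‖)) ≤ ∑ k, drift β s k * (t - s) k := by
    rw [← nsmul_eq_mul, ← smul_neg]
    refine Finset.card_nsmul_le_sum _ _ _ fun k _ => (abs_le.1 ?_).1
    rw [abs_mul]
    exact mul_le_mul (hb k) (hcoord k) (abs_nonneg _) ((abs_nonneg _).trans (hb k))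
  have hquad : ∑ k, (t - s) k ^ 2 ≤ Fintype.card ι * ‖t - s‖ ^ 2 := by
    rw [← nsmul_eq_mul]
    refine Finset.sum_le_card_nsmul _ _ _ fun k _ => ?_
    rw [← sq_abs]
    exact pow_le_pow_left₀ (abs_nonneg _) (hcoord k) 2
  have h := potential_add_le β s (t - s)
  rw [add_sub_cancel] at h
  linarith [mul_le_mul_of_nonneg_left hlin hβ, mul_le_mul_of_nonneg_left hquad hβ]

theorem exists_abs_potential_sub_le {β : ℝ} (hβ : 0 ≤ β) (R : ℝ) : ∃ D > 0, ∀ s t : ι → ℝ,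
    ‖s‖ ≤ R → ‖t‖ ≤ R →
    |potential β t - potential β s| ≤ D * (√(driftSq β s) * ‖t - s‖ + ‖t - s‖ ^ 2) := by
  obtain ⟨L, hL, hlipschitz⟩ := exists_abs_drift_sub_le (ι := ι) β R
  refine ⟨Fintype.card ι * β * (L + 1) + 1, by positivity, fun s t hs ht => ?_⟩
  have hdrift_t (k : ι) : |drift β t k| ≤ √(driftSq β s) + L * ‖t - s‖ := by
    linarith [hlipschitz t s ht hs k, abs_drift_le_sqrt β s k,
      abs_sub_abs_le_abs_sub (drift β t k) (drift β s k)]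
  have hst := potential_sub_le hβ (t := t) (abs_drift_le_sqrt β s)
  have hts := potential_sub_le hβ (t := s) hdrift_t
  rw [norm_sub_rev s t] at hts
  have hsqrt : 0 ≤ √(driftSq β s) * ‖t - s‖ := by positivity
  have hL_sqrt : 0 ≤ Fintype.card ι * β * (L * (√(driftSq β s) * ‖t - s‖)) := by positivity
  have hL_sq : 0 ≤ Fintype.card ι * β * (L * ‖t - s‖ ^ 2) := by positivity
  have hsq : 0 ≤ Fintype.card ι * β * ‖t - s‖ ^ 2 := by positivity
  rw [abs_le]
  constructor <;> linarith [sq_nonneg ‖t - s‖]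

end Softmax

/-! ### Weighted means and steps of the magnetisation -/

section WeightedMean

variable {ι : Type*} [Fintype ι]

/-- The mean of `f` with respect to the weights `w`. -/
def wmean (w f : ι → ℝ) : ℝ := ∑ i, w i * f i

theorem wmean_add (w f g : ι → ℝ) : wmean w (fun i => f i + g i) = wmean w f + wmean w g := by
  simp only [wmean, mul_add, Finset.sum_add_distrib]

theorem wmean_mul (w : ι → ℝ) (c : ℝ) (f : ι → ℝ) :
    wmean w (fun i => c * f i) = c * wmean w f := by
  simp only [wmean, Finset.mul_sum, mul_left_comm]

theorem wmean_const {w : ι → ℝ} (hw : ∑ i, w i = 1) (c : ℝ) : wmean w (fun _ => c) = c := by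
  rw [wmean, ← Finset.sum_mul, hw, one_mul]

theorem wmean_mono {w f g : ι → ℝ} (hw : ∀ i, 0 ≤ w i) (h : ∀ i, f i ≤ g i) :
    wmean w f ≤ wmean w g :=
  Finset.sum_le_sum fun i _ => mul_le_mul_of_nonneg_left (h i) (hw i)

end WeightedMean

/-- The slope `4 log 2` of the softmax map at the critical inverse temperature. -/
def critSlope : ℝ := 2 * betaCrit

theorem critSlope_eq : critSlope = 4 * Real.log 2 := by
  unfold critSlope betaCrit; ring

theorem critSlope_mem_Ioo : critSlope ∈ Set.Ioo 2.7725 2.7726 := by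
  rw [critSlope_eq]
  constructor <;> linarith [Real.log_two_gt_d9, Real.log_two_lt_d9]

theorem critSlope_pos : 0 < critSlope :=
  lt_trans (by norm_num) critSlope_mem_Ioo.1

theorem exp_critSlope_mul (x : ℝ) : Real.exp (critSlope * x) = 2 ^ (4 * x) := by
  rw [critSlope_eq, Real.rpow_def_of_pos two_pos]; ring_nf

theorem exp_critSlope : Real.exp critSlope = 16 := by
  rw [← mul_one critSlope, exp_critSlope_mul]; norm_num

/-- The law of one step of a Markov chain on the simplex started at `s` at the critical
temperature: the chain moves by `δ • v i` with probability `w i`. The mean of `v` is the mean-field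
drift up to an error `L * δ`, and every coordinate of `v` has second moment at least
`1 / 48 = exp (-critSlope) / 3`. -/
structure IsStep (L δ : ℝ) (s : Fin 3 → ℝ) {ι : Type*} [Fintype ι] (w : ι → ℝ)
    (v : ι → Fin 3 → ℝ) : Prop where
  mem : s ∈ stdSimplex ℝ (Fin 3)
  mem_add : ∀ i, s + δ • v i ∈ stdSimplex ℝ (Fin 3)
  nonneg : ∀ i, 0 ≤ w i
  sum_one : ∑ i, w i = 1
  abs_le_one : ∀ i k, |v i k| ≤ 1
  mean : ∀ k, |wmean w (fun i => v i k) - drift critSlope s k| ≤ L * δ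
  var : ∀ k, 1 / 48 ≤ wmean w fun i => v i k ^ 2

/-! ### Glauber dynamics -/

theorem sum_sq_add_single {ι : Type*} [Fintype ι] [DecidableEq ι] (t : ι → ℝ) (c : ι) (a : ℝ) :
    ∑ k, (t + Pi.single c a : ι → ℝ) k ^ 2 = ∑ k, t k ^ 2 + 2 * a * t c + a ^ 2 := by
  simp only [Pi.add_apply, add_sq, Finset.sum_add_distrib, Pi.single_apply, ite_pow, mul_ite,
    mul_zero, ne_eq, OfNat.ofNat_ne_zero, not_false_eq_true, zero_pow, Finset.sum_ite_eq',
    Finset.mem_univ, if_true]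
  ring

section Glauber

variable {M : ℕ}

theorem sum_spins_eq_sum_magnetisation_mul (σ : Config M) (f : Fin 3 → ℝ) :
    ∑ l, 1 / (M : ℝ) * f (σ l) = ∑ c, magnetisation σ c * f c := by
  rw [← Finset.sum_fiberwise Finset.univ σ]
  refine Finset.sum_congr rfl fun c _ => ?_
  rw [Finset.sum_congr rfl fun l hl => by rw [(Finset.mem_filter.1 hl).2], Finset.sum_const,
    nsmul_eq_mul, magnetisation]
  ring

theorem magnetisation_mem_stdSimplex (hM : M ≠ 0) (σ : Config M) :
    magnetisation σ ∈ stdSimplex ℝ (Fin 3) := by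
  refine ⟨fun k => div_nonneg (Nat.cast_nonneg _) (Nat.cast_nonneg _), ?_⟩
  have h := sum_spins_eq_sum_magnetisation_mul σ 1
  simp only [Pi.one_apply, mul_one] at h
  rw [← h, Fin.sum_const, nsmul_eq_mul, mul_one_div_cancel (Nat.cast_ne_zero.2 hM)]

theorem magnetisation_update (σ : Config M) (l : Fin M) (c : Fin 3) :
    magnetisation (Function.update σ l c) =
      magnetisation σ - Pi.single (σ l) (1 / (M : ℝ)) + Pi.single c (1 / (M : ℝ)) := by
  have hsum (τ : Config M) (k : Fin 3) :
      magnetisation τ k = ∑ i, (Pi.single (τ i) (1 / (M : ℝ)) : Fin 3 → ℝ) k := by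
    simp only [magnetisation, Pi.single_apply, Finset.card_filter, Nat.cast_sum, Finset.sum_div,
      @eq_comm _ k, Nat.cast_ite, Nat.cast_one, Nat.cast_zero, ite_div, zero_div]
  have hrest (k : Fin 3) :
      ∑ i ∈ Finset.univ.erase l,
          (Pi.single (Function.update σ l c i) (1 / (M : ℝ)) : Fin 3 → ℝ) k =
        ∑ i ∈ Finset.univ.erase l, (Pi.single (σ i) (1 / (M : ℝ)) : Fin 3 → ℝ) k :=
    Finset.sum_congr rfl fun i hi => by rw [Function.update_of_ne (Finset.ne_of_mem_erase hi)]
  ext k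
  simp only [Pi.add_apply, Pi.sub_apply, hsum]
  rw [← Finset.add_sum_erase _ _ (Finset.mem_univ l), hrest, Function.update_self,
    ← Finset.add_sum_erase _ (fun i => (Pi.single (σ i) (1 / (M : ℝ)) : Fin 3 → ℝ) k)
      (Finset.mem_univ l)]
  ring

theorem spinCondProb_eq_softmax (hM : M ≠ 0) (β : ℝ) (σ : Config M) (l : Fin M) (c : Fin 3) :
    spinCondProb M β σ l c =
      softmax (2 * β) (magnetisation σ - Pi.single (σ l) (1 / (M : ℝ))) c := by
  set t := magnetisation σ - Pi.single (σ l) (1 / (M : ℝ)) with ht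
  have hweight (c : Fin 3) : gibbsWeight M β (Function.update σ l c) =
      Real.exp (M * β * (∑ k, t k ^ 2 + (1 / (M : ℝ)) ^ 2)) * Real.exp (2 * β * t c) := by
    have hM' : (M : ℝ) ≠ 0 := Nat.cast_ne_zero.2 hM
    rw [gibbsWeight, magnetisation_update, ← ht, ← Real.exp_add, sum_sq_add_single]
    congr 1
    field_simp
    ring
  have hZ : (∑ τ : Config M, gibbsWeight M β τ) ≠ 0 :=
    have : Nonempty (Config M) := ⟨σ⟩
    (Finset.sum_pos (fun _ _ => Real.exp_pos _) Finset.univ_nonempty).ne'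
  simp only [spinCondProb, gibbs]
  rw [← Finset.sum_div, div_div_div_cancel_right₀ hZ]
  simp_rw [hweight]
  rw [← Finset.mul_sum, mul_div_mul_left _ _ (Real.exp_pos _).ne', softmax]

theorem sum_glauber_mul (β : ℝ) (σ : Config M) (f : Config M → ℝ) :
    ∑ τ, glauber M β σ τ * f τ =
      ∑ l, 1 / (M : ℝ) * ∑ c, spinCondProb M β σ l c * f (Function.update σ l c) := by
  simp only [glauber, Finset.sum_mul, mul_assoc, Finset.mul_sum, ite_mul, zero_mul, mul_ite,
    mul_zero]
  rw [Finset.sum_comm]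
  refine Finset.sum_congr rfl fun l _ => ?_
  rw [Finset.sum_comm]
  refine Finset.sum_congr rfl fun c _ => ?_
  rw [Finset.sum_ite_eq, if_pos (Finset.mem_univ _)]

theorem spinCondProb_nonneg (β : ℝ) (σ : Config M) (l : Fin M) (c : Fin 3) :
    0 ≤ spinCondProb M β σ l c := by
  unfold spinCondProb gibbs gibbsWeight
  positivity

theorem sum_spinCondProb (hM : M ≠ 0) (β : ℝ) (σ : Config M) (l : Fin M) :
    ∑ c, spinCondProb M β σ l c = 1 := by
  simp_rw [spinCondProb_eq_softmax hM, sum_softmax]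

theorem glauber_nonneg (β : ℝ) (σ τ : Config M) : 0 ≤ glauber M β σ τ := by
  refine Finset.sum_nonneg fun l _ => mul_nonneg (by positivity) (Finset.sum_nonneg fun c _ => ?_)
  split_ifs
  exacts [spinCondProb_nonneg β σ l c, le_rfl]

theorem sum_glauber (hM : M ≠ 0) (β : ℝ) (σ : Config M) : ∑ τ, glauber M β σ τ = 1 := by
  have h := sum_glauber_mul β σ fun _ => 1
  simp only [mul_one, sum_spinCondProb hM, Finset.sum_const, Finset.card_univ, Fintype.card_fin,
    nsmul_eq_mul] at h
  rw [h, mul_one_div_cancel (Nat.cast_ne_zero.2 hM)]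

/-- The probability that a step of the Glauber dynamics from `σ` chooses the spin `p.1` and gives
it the colour `p.2`. -/
def stepWeight (β : ℝ) (σ : Config M) (p : Fin M × Fin 3) : ℝ :=
  1 / (M : ℝ) * spinCondProb M β σ p.1 p.2

/-- `M` times the increment of the magnetisation when the spin `p.1` gets the colour `p.2`. -/
def stepIncr (σ : Config M) (p : Fin M × Fin 3) : Fin 3 → ℝ :=
  Pi.single p.2 1 - Pi.single (σ p.1) 1

theorem sum_glauber_eq_wmean (β : ℝ) (σ : Config M) (f : Config M → ℝ) :
    ∑ τ, glauber M β σ τ * f τ =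
      wmean (stepWeight β σ) fun p => f (Function.update σ p.1 p.2) := by
  simp only [sum_glauber_mul, wmean, Fintype.sum_prod_type, Finset.mul_sum, stepWeight, mul_assoc]

theorem stepWeight_nonneg (β : ℝ) (σ : Config M) (p : Fin M × Fin 3) : 0 ≤ stepWeight β σ p :=
  mul_nonneg (by positivity) (spinCondProb_nonneg ..)

theorem sum_stepWeight (hM : M ≠ 0) (β : ℝ) (σ : Config M) : ∑ p, stepWeight β σ p = 1 := by
  have h := sum_glauber_eq_wmean β σ fun _ => 1
  simpa only [mul_one, sum_glauber hM, wmean, eq_comm] using h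

theorem magnetisation_add_stepIncr (σ : Config M) (p : Fin M × Fin 3) :
    magnetisation σ + (1 / (M : ℝ)) • stepIncr σ p =
      magnetisation (Function.update σ p.1 p.2) := by
  rw [magnetisation_update, stepIncr, smul_sub, ← Pi.single_smul, ← Pi.single_smul, smul_eq_mul,
    mul_one]
  abel

theorem abs_stepIncr_le_one (σ : Config M) (p : Fin M × Fin 3) (k : Fin 3) :
    |stepIncr σ p k| ≤ 1 := by
  simp only [stepIncr, Pi.sub_apply, Pi.single_apply]
  split_ifs <;> norm_num

theorem exists_sq_stepIncr_eq_one (σ : Config M) (l : Fin M) (k : Fin 3) :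
    ∃ c, stepIncr σ (l, c) k ^ 2 = 1 := by
  by_cases hk : σ l = k
  · refine ⟨k + 1, ?_⟩
    simp [stepIncr, hk]
  · refine ⟨k, ?_⟩
    simp [stepIncr, Ne.symm hk]

theorem wmean_stepIncr (hM : M ≠ 0) (β : ℝ) (σ : Config M) (k : Fin 3) :
    wmean (stepWeight β σ) (fun p => stepIncr σ p k) =
      ∑ l, 1 / (M : ℝ) * softmax (2 * β) (magnetisation σ - Pi.single (σ l) (1 / (M : ℝ))) k -
        magnetisation σ k := by
  have hspin (l : Fin M) : ∑ c, stepWeight β σ (l, c) * stepIncr σ (l, c) k =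
      1 / (M : ℝ) * spinCondProb M β σ l k - 1 / (M : ℝ) * (Pi.single (σ l) 1 : Fin 3 → ℝ) k := by
    simp only [stepWeight, stepIncr, Pi.sub_apply, mul_sub, Finset.sum_sub_distrib,
      ← Finset.sum_mul, ← Finset.mul_sum, sum_spinCondProb hM, mul_one]
    simp only [Pi.single_apply, mul_ite, mul_one, mul_zero, Finset.sum_ite_eq, Finset.mem_univ,
      if_true]
  have hcurrent : ∑ l, 1 / (M : ℝ) * (Pi.single (σ l) 1 : Fin 3 → ℝ) k = magnetisation σ k := by
    rw [sum_spins_eq_sum_magnetisation_mul σ fun c => (Pi.single c 1 : Fin 3 → ℝ) k]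
    simp only [Pi.single_apply, mul_ite, mul_one, mul_zero, Finset.sum_ite_eq, Finset.mem_univ,
      if_true]
  rw [wmean, Fintype.sum_prod_type, Finset.sum_congr rfl fun l _ => hspin l,
    Finset.sum_sub_distrib, hcurrent]
  simp only [spinCondProb_eq_softmax hM]

theorem sub_single_mem_Icc (hM : M ≠ 0) (σ : Config M) (l : Fin M) (k : Fin 3) :
    (magnetisation σ - Pi.single (σ l) (1 / (M : ℝ)) : Fin 3 → ℝ) k ∈ Set.Icc 0 1 := by
  have hk := mem_Icc_of_mem_stdSimplex (magnetisation_mem_stdSimplex hM σ) k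
  have hM0 : (0 : ℝ) ≤ 1 / M := by positivity
  rw [Pi.sub_apply, Pi.single_apply]
  split_ifs with hkl
  · have hcard : 1 / (M : ℝ) ≤ magnetisation σ k := by
      refine div_le_div_of_nonneg_right ?_ (Nat.cast_nonneg M)
      exact_mod_cast Finset.card_pos.2 ⟨l, Finset.mem_filter.2 ⟨Finset.mem_univ l, hkl.symm⟩⟩
    exact ⟨sub_nonneg.2 hcard, (sub_le_self _ hM0).trans hk.2⟩
  · rwa [sub_zero]

theorem exists_abs_wmean_stepIncr_sub_drift_le (β : ℝ) : ∃ L > 0, ∀ (M : ℕ), M ≠ 0 →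
    ∀ (σ : Config M) (k : Fin 3),
      |wmean (stepWeight β σ) (fun p => stepIncr σ p k) - drift (2 * β) (magnetisation σ) k| ≤
        L * (1 / (M : ℝ)) := by
  obtain ⟨L, hL, hlip⟩ := exists_abs_softmax_sub_le (ι := Fin 3) (2 * β) 1
  refine ⟨L, hL, fun M hM σ k => ?_⟩
  have hsum : ∑ _l : Fin M, 1 / (M : ℝ) = 1 := by
    rw [Fin.sum_const, nsmul_eq_mul, mul_one_div_cancel (Nat.cast_ne_zero.2 hM)]
  have hnorm {s : Fin 3 → ℝ} (hs : ∀ k, s k ∈ Set.Icc 0 1) : ‖s‖ ≤ 1 :=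
    (pi_norm_le_iff_of_nonneg zero_le_one).2 fun k => by
      rw [Real.norm_of_nonneg (hs k).1]; exact (hs k).2
  set t := fun l => magnetisation σ - Pi.single (σ l) (1 / (M : ℝ))
  calc |wmean (stepWeight β σ) (fun p => stepIncr σ p k) - drift (2 * β) (magnetisation σ) k|
      = |∑ l, 1 / (M : ℝ) * (softmax (2 * β) (t l) k - softmax (2 * β) (magnetisation σ) k)| := by
        simp only [wmean_stepIncr hM, drift, mul_sub, Finset.sum_sub_distrib]
        rw [← Finset.sum_mul, hsum]
        congr 1; ring
    _ ≤ ∑ l, |1 / (M : ℝ) * (softmax (2 * β) (t l) k - softmax (2 * β) (magnetisation σ) k)| :=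
        Finset.abs_sum_le_sum_abs _ _
    _ ≤ ∑ _l : Fin M, 1 / (M : ℝ) * (L * (1 / (M : ℝ))) := by
        refine Finset.sum_le_sum fun l _ => ?_
        rw [abs_mul, abs_of_nonneg (by positivity : (0 : ℝ) ≤ 1 / M)]
        gcongr
        refine (hlip _ _ (hnorm (sub_single_mem_Icc hM σ l)) (hnorm (mem_Icc_of_mem_stdSimplex
          (magnetisation_mem_stdSimplex hM σ))) k).trans_eq ?_
        rw [sub_sub_cancel_left, norm_neg, Pi.norm_single,
          Real.norm_of_nonneg (by positivity)]
    _ = L * (1 / (M : ℝ)) := by rw [← Finset.sum_mul, hsum, one_mul]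

theorem le_spinCondProb_betaCrit (hM : M ≠ 0) (σ : Config M) (l : Fin M) (c : Fin 3) :
    1 / 48 ≤ spinCondProb M betaCrit σ l c := by
  rw [spinCondProb_eq_softmax hM]
  refine le_of_eq_of_le ?_ (exp_neg_div_card_le_softmax critSlope_pos.le
    (sub_single_mem_Icc hM σ l) c)
  rw [Real.exp_neg, exp_critSlope, Fintype.card_fin]
  norm_num

theorem one_div_mul_spinCondProb_le_glauber (β : ℝ) (σ : Config M) (l : Fin M) (c : Fin 3) :
    1 / (M : ℝ) * spinCondProb M β σ l c ≤ glauber M β σ (Function.update σ l c) := by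
  have hterm (l' : Fin M) (c' : Fin 3) :
      0 ≤ if Function.update σ l' c' = Function.update σ l c then spinCondProb M β σ l' c'
        else 0 := by
    split_ifs
    exacts [spinCondProb_nonneg β σ l' c', le_rfl]
  have hcolour := Finset.single_le_sum (fun c' _ => hterm l c') (Finset.mem_univ c)
  rw [if_pos rfl] at hcolour
  exact (mul_le_mul_of_nonneg_left hcolour (by positivity)).trans
    (Finset.single_le_sum (f := fun l' => 1 / (M : ℝ) * ∑ c', _)
      (fun l' _ => mul_nonneg (by positivity) (Finset.sum_nonneg fun c' _ => hterm l' c'))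
      (Finset.mem_univ l))

theorem le_wmean_sq_stepIncr (hM : M ≠ 0) (σ : Config M) (k : Fin 3) :
    1 / 48 ≤ wmean (stepWeight betaCrit σ) fun p => stepIncr σ p k ^ 2 := by
  have hspin (l : Fin M) : 1 / (M : ℝ) * (1 / 48) ≤
      ∑ c, stepWeight betaCrit σ (l, c) * stepIncr σ (l, c) k ^ 2 := by
    obtain ⟨c, hc⟩ := exists_sq_stepIncr_eq_one σ l k
    have hterm := Finset.single_le_sum
      (f := fun c => stepWeight betaCrit σ (l, c) * stepIncr σ (l, c) k ^ 2)
      (fun c _ => mul_nonneg (stepWeight_nonneg ..) (sq_nonneg _)) (Finset.mem_univ c)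
    rw [hc, mul_one] at hterm
    exact (mul_le_mul_of_nonneg_left (le_spinCondProb_betaCrit hM σ l c) (by positivity)).trans
      hterm
  rw [wmean, Fintype.sum_prod_type]
  refine le_of_eq_of_le ?_ (Finset.sum_le_sum fun l _ => hspin l)
  rw [Fin.sum_const, nsmul_eq_mul, ← mul_assoc, mul_one_div_cancel (Nat.cast_ne_zero.2 hM), one_mul]

theorem exists_isStep_glauber : ∃ L > 0, ∀ (M : ℕ), M ≠ 0 → ∀ σ : Config M,
    IsStep L (1 / (M : ℝ)) (magnetisation σ) (stepWeight betaCrit σ) (stepIncr σ) := by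
  obtain ⟨L, hL, hmean⟩ := exists_abs_wmean_stepIncr_sub_drift_le betaCrit
  refine ⟨L, hL, fun M hM σ => ⟨magnetisation_mem_stdSimplex hM σ, fun p => ?_,
    stepWeight_nonneg betaCrit σ, sum_stepWeight hM betaCrit σ, abs_stepIncr_le_one σ,
    hmean M hM σ, le_wmean_sq_stepIncr hM σ⟩⟩
  rw [magnetisation_add_stepIncr]
  exact magnetisation_mem_stdSimplex hM _

end Glauber

/-! ### Fixed points of the mean-field dynamics -/

section FixedPoints

theorem lt_of_strictConcaveOn_of_eq {S : Set ℝ} {f : ℝ → ℝ} (hf : StrictConcaveOn ℝ S f)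
    {x y z : ℝ} (hx : x ∈ S) (hz : z ∈ S) (hxy : x < y) (hyz : y < z) (hfxz : f x = f z) :
    f x < f y := by
  have h := hf.lt_on_openSegment hx hz (hxy.trans hyz).ne
    ((openSegment_eq_Ioo (hxy.trans hyz)).symm ▸ Set.mem_Ioo.2 ⟨hxy, hyz⟩)
  rwa [← hfxz, min_self] at h

theorem eq_or_eq_or_eq_of_strictConcaveOn {S : Set ℝ} {f : ℝ → ℝ} (hf : StrictConcaveOn ℝ S f)
    {x y z : ℝ} (hx : x ∈ S) (hy : y ∈ S) (hz : z ∈ S) (hxy : f x = f y) (hyz : f y = f z) :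
    y = z ∨ z = x ∨ x = y := by
  have hmid {p q r : ℝ} (hp : p ∈ S) (hr : r ∈ S) (hpr : f p = f r) (hpq : f p = f q) :
      ¬(p < q ∧ q < r) :=
    fun h => (lt_of_strictConcaveOn_of_eq hf hp hr h.1 h.2 hpr).ne hpq
  have h₁ := hmid hx hz (hxy.trans hyz) hxy
  have h₂ := hmid hx hy hxy (hxy.trans hyz)
  have h₃ := hmid hy hx hxy.symm hyz
  have h₄ := hmid hy hz hyz hxy.symm
  have h₅ := hmid hz hx (hxy.trans hyz).symm hyz.symm
  have h₆ := hmid hz hy hyz.symm (hxy.trans hyz).symm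
  grind

theorem strictConcaveOn_log_sub_mul (a : ℝ) :
    StrictConcaveOn ℝ (Set.Ioi 0) fun x => Real.log x - a * x :=
  strictConcaveOn_log_Ioi.sub_convexOn ((LinearMap.mulLeft ℝ a).convexOn (convex_Ioi 0))

/-- The defect in the fixed point equation of a magnetisation with two equal coordinates,
parametrised by `u`, the difference of the distinct coordinates minus `1 / 4`. Criticality makes it
odd. -/
def fixedPointDefect (u : ℝ) : ℝ :=
  critSlope * u - (Real.log (3 / 4 + u) - Real.log (3 / 4 - u))

theorem fixedPointDefect_zero : fixedPointDefect 0 = 0 := by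
  simp [fixedPointDefect]

theorem fixedPointDefect_neg (u : ℝ) : fixedPointDefect (-u) = -fixedPointDefect u := by
  rw [fixedPointDefect, fixedPointDefect, sub_neg_eq_add, ← sub_eq_add_neg]; ring

theorem fixedPointDefect_quarter : fixedPointDefect (1 / 4) = 0 := by
  rw [fixedPointDefect, critSlope_eq, show (3 / 4 - 1 / 4 : ℝ) = 2⁻¹ by norm_num, Real.log_inv]
  norm_num; ring

theorem hasDerivAt_fixedPointDefect {u : ℝ} (hu : u ∈ Set.Ioo (-(3 / 4)) (3 / 4)) :
    HasDerivAt fixedPointDefect (critSlope - 3 / 2 / (9 / 16 - u ^ 2)) u := by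
  have hplus : 3 / 4 + u ≠ 0 := by linarith [hu.1]
  have hminus : 3 / 4 - u ≠ 0 := by linarith [hu.2]
  have hlogs := (((hasDerivAt_id u).const_add (3 / 4)).log hplus).sub
    (((hasDerivAt_id u).const_sub (3 / 4)).log hminus)
  refine (((hasDerivAt_id u).const_mul critSlope).sub hlogs).congr_deriv ?_
  have hsum := div_add_div 1 1 hplus hminus
  rw [show (3 / 4 + u) * (3 / 4 - u) = 9 / 16 - u ^ 2 by ring] at hsum
  simp only [id]
  linear_combination -hsum

theorem strictConcaveOn_fixedPointDefect :
    StrictConcaveOn ℝ (Set.Ico 0 (3 / 4)) fixedPointDefect := by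
  have hderiv {u : ℝ} (h₀ : 0 ≤ u) (h₁ : u < 3 / 4) :=
    hasDerivAt_fixedPointDefect ⟨by linarith, h₁⟩
  refine StrictAntiOn.strictConcaveOn_of_deriv (convex_Ico _ _)
    (fun u hu => (hderiv hu.1 hu.2).continuousAt.continuousWithinAt) ?_
  rw [interior_Ico]
  intro u hu v hv huv
  rw [(hderiv hu.1.le hu.2).deriv, (hderiv hv.1.le hv.2).deriv]
  have hsq : u ^ 2 < v ^ 2 := pow_lt_pow_left₀ huv hu.1.le two_ne_zero
  have hpos : 0 < 9 / 16 - v ^ 2 := by nlinarith [hv.1, hv.2]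
  gcongr

theorem fixedPointDefect_eq_zero {u : ℝ} (hu : u ∈ Set.Ioo (-(3 / 4)) (3 / 4))
    (h : fixedPointDefect u = 0) : u = 0 ∨ u = 1 / 4 ∨ u = -(1 / 4) := by
  have hnonneg {v : ℝ} (hv : v ∈ Set.Ico 0 (3 / 4)) (hv0 : fixedPointDefect v = 0) :
      v = 0 ∨ v = 1 / 4 := by
    rcases eq_or_eq_or_eq_of_strictConcaveOn strictConcaveOn_fixedPointDefect
      (x := 0) (y := 1 / 4) (by norm_num) (by norm_num) hv
      (by rw [fixedPointDefect_zero, fixedPointDefect_quarter])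
      (by rw [fixedPointDefect_quarter, hv0]) with h | h | h
    · exact Or.inr h.symm
    · exact Or.inl h
    · norm_num at h
  rcases le_total 0 u with h₀ | h₀
  · exact (hnonneg ⟨h₀, hu.2⟩ h).imp_right Or.inl
  · have := hnonneg (v := -u) ⟨by linarith, by linarith [hu.1]⟩
      (by rw [fixedPointDefect_neg, h, neg_zero])
    grind

/-- The saddle points of the mean-field free energy at the critical temperature. -/
def saddle (i k : Fin 3) : ℝ := if k = i then 1 / 2 else 1 / 4

theorem centre_castSucc (i k : Fin 3) :
    centre i.castSucc k = if k = i then 2 / 3 else 1 / 6 := by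
  fin_cases i <;> fin_cases k <;> rfl

theorem centre_last (k : Fin 3) : centre (Fin.last 3) k = 1 / 3 := by
  fin_cases k <;> rfl

theorem eq_ite_of_two_eq {s : Fin 3 → ℝ} {i : Fin 3} (h : s (i + 1) = s (i + 2)) :
    s = fun k => if k = i then s i else s (i + 1) := by
  ext k
  fin_cases i <;> fin_cases k <;> first | rfl | exact h.symm

theorem eq_saddle_or_centre_of_two_eq {s : Fin 3 → ℝ} (hs : ∑ k, s k = 1) (hpos : ∀ k, 0 < s k)
    {i : Fin 3} (heq : s (i + 1) = s (i + 2))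
    (hfix : Real.log (s i) - critSlope * s i = Real.log (s (i + 1)) - critSlope * s (i + 1)) :
    s = saddle i ∨ ∃ j, s = centre j := by
  have hsum : s i + 2 * s (i + 1) = 1 := by
    rw [two_mul, ← add_assoc, ← hs, Fin.sum_univ_three]
    nth_rw 2 [heq]
    fin_cases i <;>
      simp only [Fin.zero_eta, Fin.mk_one, Fin.reduceFinMk, Fin.reduceAdd, zero_add] <;> ring
  have hplus : 3 / 4 + (s i - s (i + 1) - 1 / 4) = 3 / 2 * s i := by linarith
  have hminus : 3 / 4 - (s i - s (i + 1) - 1 / 4) = 3 / 2 * 2 * s (i + 1) := by linarith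
  have hdefect : fixedPointDefect (s i - s (i + 1) - 1 / 4) = 0 := by
    rw [fixedPointDefect, hplus, hminus, Real.log_mul (by norm_num) (hpos i).ne',
      Real.log_mul (by norm_num) (hpos _).ne', Real.log_mul (by norm_num) (by norm_num)]
    linarith [critSlope_eq]
  have hs_eq := eq_ite_of_two_eq heq
  rcases fixedPointDefect_eq_zero ⟨by linarith [hpos i], by linarith [hpos (i + 1)]⟩ hdefect
    with h | h | h
  · left
    rw [hs_eq, show s i = 1 / 2 by linarith, show s (i + 1) = 1 / 4 by linarith]
    rfl
  · right
    refine ⟨i.castSucc, ?_⟩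
    ext k
    rw [hs_eq, show s i = 2 / 3 by linarith, show s (i + 1) = 1 / 6 by linarith, centre_castSucc]
  · right
    refine ⟨Fin.last 3, ?_⟩
    ext k
    rw [hs_eq, show s i = 1 / 3 by linarith, show s (i + 1) = 1 / 3 by linarith, centre_last]
    exact ite_self _

theorem eq_saddle_or_centre_of_drift_eq_zero {s : Fin 3 → ℝ} (hs : ∑ k, s k = 1)
    (h : ∀ k, drift critSlope s k = 0) : (∃ i, s = saddle i) ∨ ∃ j, s = centre j := by
  have hfix (k : Fin 3) : softmax critSlope s k = s k := sub_eq_zero.1 (h k)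
  have hpos (k : Fin 3) : 0 < s k := hfix k ▸ softmax_pos critSlope s k
  have hlog (j k : Fin 3) :
      Real.log (s j) - critSlope * s j = Real.log (s k) - critSlope * s k := by
    rw [← hfix j, ← hfix k, log_softmax, log_softmax, hfix, hfix]; ring
  obtain ⟨i, hi⟩ : ∃ i : Fin 3, s (i + 1) = s (i + 2) := by
    rcases eq_or_eq_or_eq_of_strictConcaveOn (strictConcaveOn_log_sub_mul critSlope)
      (hpos 0) (hpos 1) (hpos 2) (hlog 0 1) (hlog 1 2) with h | h | h
    exacts [⟨0, h⟩, ⟨1, h⟩, ⟨2, h⟩]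
  exact (eq_saddle_or_centre_of_two_eq hs hpos hi (hlog i (i + 1))).imp_left fun h => ⟨i, h⟩

end FixedPoints

section Saddles

theorem saddle_mem_stdSimplex (i : Fin 3) : saddle i ∈ stdSimplex ℝ (Fin 3) := by
  refine ⟨fun k => ?_, ?_⟩
  · unfold saddle; split_ifs <;> norm_num
  · fin_cases i <;> simp [Fin.sum_univ_three, saddle] <;> norm_num

theorem norm_saddle (i : Fin 3) : ‖saddle i‖ = 1 / 2 := by
  refine le_antisymm ((pi_norm_le_iff_of_nonneg (by norm_num)).2 fun k => ?_) ?_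
  · unfold saddle; split_ifs <;> norm_num
  · simpa [saddle] using norm_le_pi_norm (saddle i) i

theorem sum_saddle_mul (i : Fin 3) {w : Fin 3 → ℝ} (hw : ∑ k, w k = 0) :
    ∑ k, saddle i k * w k = w i / 4 := by
  have hsplit (k : Fin 3) : saddle i k * w k = 1 / 4 * w k + if k = i then 1 / 4 * w k else 0 := by
    unfold saddle; split_ifs <;> ring
  simp only [hsplit, Finset.sum_add_distrib, ← Finset.mul_sum, hw, Finset.sum_ite_eq',
    Finset.mem_univ, if_true]
  ring

theorem exp_critSlope_mul_saddle (i k : Fin 3) :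
    Real.exp (critSlope * saddle i k) = 8 * saddle i k := by
  rw [exp_critSlope_mul]
  unfold saddle; split_ifs <;> norm_num

theorem softmax_saddle (i : Fin 3) : softmax critSlope (saddle i) = saddle i := by
  ext k
  simp only [softmax, exp_critSlope_mul_saddle, ← Finset.mul_sum, (saddle_mem_stdSimplex i).2,
    mul_one]
  ring

theorem potential_saddle (i j : Fin 3) :
    potential critSlope (saddle i) = potential critSlope (saddle j) := by
  have hsq (i : Fin 3) : ∑ k, saddle i k ^ 2 = 3 / 8 := by
    fin_cases i <;> simp [saddle, Fin.sum_univ_three] <;> norm_num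
  simp only [potential, exp_critSlope_mul_saddle, ← Finset.mul_sum,
    (saddle_mem_stdSimplex _).2, hsq]

/-- The linearisation of the drift at the saddle `i`, applied to a displacement `w` whose
coordinates sum to zero. Its `i`-th coordinate is `(3 / 8 * critSlope - 1) * w i`, so the `i`-th
direction is unstable. -/
def saddleDrift (i : Fin 3) (w : Fin 3 → ℝ) (k : Fin 3) : ℝ :=
  critSlope * saddle i k * (w k - w i / 4) - w k

theorem exists_abs_drift_sub_saddleDrift_le {κ : ℝ} (hκ : 0 < κ) : ∃ r > 0, ∀ (i : Fin 3)
    (s : Fin 3 → ℝ), ∑ k, s k = 1 → ‖s - saddle i‖ ≤ r → ∀ k,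
      |drift critSlope s k - saddleDrift i (s - saddle i) k| ≤ κ * ‖s - saddle i‖ := by
  choose r hr hdrift using fun i => exists_drift_expansion_of_fixed (softmax_saddle i) hκ
  obtain ⟨j, hj⟩ := Finite.exists_min r
  refine ⟨r j, hr j, fun i s hs hsr k => ?_⟩
  have hsum : ∑ k, (s - saddle i) k = 0 := by
    simp only [Pi.sub_apply, Finset.sum_sub_distrib, hs, (saddle_mem_stdSimplex i).2, sub_self]
  have h := hdrift i s (hsr.trans (hj i)) k
  rwa [sum_saddle_mul i hsum] at h

theorem saddleDrift_self (i : Fin 3) (w : Fin 3 → ℝ) :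
    saddleDrift i w i = (3 / 8 * critSlope - 1) * w i := by
  rw [saddleDrift, saddle, if_pos rfl]; ring

theorem saddleDrift_of_ne {i k : Fin 3} (hk : k ≠ i) (w : Fin 3 → ℝ) :
    saddleDrift i w k = critSlope / 16 * -w i - (1 - critSlope / 4) * w k := by
  rw [saddleDrift, saddle, if_neg hk]; ring

theorem exists_norm_le_abs_saddleDrift (i : Fin 3) (w : Fin 3 → ℝ) :
    ∃ k, ‖w‖ / 500 ≤ |saddleDrift i w k| := by
  obtain ⟨hlow, hup⟩ := critSlope_mem_Ioo
  rcases le_or_gt (‖w‖ / 8) |w i| with hi | hi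
  · refine ⟨i, ?_⟩
    rw [saddleDrift_self, abs_mul]
    calc ‖w‖ / 500 ≤ 1 / 30 * (‖w‖ / 8) := by linarith [norm_nonneg w]
      _ ≤ |3 / 8 * critSlope - 1| * |w i| :=
        mul_le_mul (le_trans (by linarith) (le_abs_self _)) hi (by positivity) (abs_nonneg _)
  · obtain ⟨k, hk⟩ := Finite.exists_max fun k => ‖w k‖
    have hwk : ‖w‖ ≤ |w k| := (pi_norm_le_iff_of_nonneg (norm_nonneg _)).2 hk
    have hne : k ≠ i := by
      rintro rfl
      linarith [abs_nonneg (w k)]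
    refine ⟨k, ?_⟩
    have htriangle := abs_sub_abs_le_abs_sub ((1 - critSlope / 4) * w k) (critSlope / 16 * -w i)
    rw [abs_sub_comm, ← saddleDrift_of_ne hne, abs_mul, abs_mul, abs_neg,
      abs_of_pos (by linarith : 0 < 1 - critSlope / 4),
      abs_of_pos (by linarith : 0 < critSlope / 16)] at htriangle
    have hstable : 3 / 10 * ‖w‖ ≤ (1 - critSlope / 4) * |w k| :=
      mul_le_mul (by linarith) hwk (norm_nonneg _) (by linarith)
    have hcross : critSlope / 16 * |w i| ≤ 1 / 5 * (‖w‖ / 8) :=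
      mul_le_mul (by linarith) hi.le (abs_nonneg _) (by norm_num)
    linarith [norm_nonneg w]

theorem exists_norm_sub_saddle_le_driftSq : ∃ r > 0, ∀ (i : Fin 3) (s : Fin 3 → ℝ),
    ∑ k, s k = 1 → ‖s - saddle i‖ ≤ r →
      (‖s - saddle i‖ / 1000) ^ 2 ≤ driftSq critSlope s := by
  obtain ⟨r, hr, hdrift⟩ := exists_abs_drift_sub_saddleDrift_le (κ := 1 / 1000) (by norm_num)
  refine ⟨r, hr, fun i s hs hsr => ?_⟩
  obtain ⟨k, hk⟩ := exists_norm_le_abs_saddleDrift i (s - saddle i)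
  have htriangle := abs_sub_abs_le_abs_sub (saddleDrift i (s - saddle i) k) (drift critSlope s k)
  rw [abs_sub_comm] at htriangle
  refine le_trans ?_ (sq_drift_le_driftSq critSlope s k)
  rw [← sq_abs (drift _ _ _)]
  exact pow_le_pow_left₀ (by positivity) (by linarith [hdrift i s hs hsr k]) 2

theorem exists_unstable_radius {κ : ℝ} (hκ : 0 < κ) : ∃ r > 0, ∀ (i : Fin 3) (s : Fin 3 → ℝ),
    ∑ k, s k = 1 → ‖s - saddle i‖ ≤ r →
      -(κ * ‖s - saddle i‖ ^ 2) ≤ (s i - 1 / 2) * drift critSlope s i := by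
  obtain ⟨r, hr, hdrift⟩ := exists_abs_drift_sub_saddleDrift_le hκ
  refine ⟨r, hr, fun i s hs hsr => ?_⟩
  have hx : |s i - 1 / 2| ≤ ‖s - saddle i‖ := by
    simpa [saddle] using norm_le_pi_norm (s - saddle i) i
  have h := hdrift i s hs hsr i
  rw [saddleDrift_self, Pi.sub_apply, saddle, if_pos rfl] at h
  have hprod := mul_le_mul hx h (abs_nonneg _) (norm_nonneg _)
  rw [← abs_mul] at hprod
  have hpos : 0 ≤ (3 / 8 * critSlope - 1) * (s i - 1 / 2) ^ 2 :=
    mul_nonneg (by linarith [critSlope_mem_Ioo.1]) (sq_nonneg _)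
  linarith [(abs_le.1 hprod).1]

/-- The distance to the closest saddle point, in the supremum norm. -/
def saddleDist (s : Fin 3 → ℝ) : ℝ := Metric.infDist s (Set.range saddle)

theorem saddleDist_nonneg (s : Fin 3 → ℝ) : 0 ≤ saddleDist s := Metric.infDist_nonneg

theorem saddleDist_le (s : Fin 3 → ℝ) (i : Fin 3) : saddleDist s ≤ ‖s - saddle i‖ :=
  (Metric.infDist_le_dist_of_mem (Set.mem_range_self i)).trans_eq (dist_eq_norm _ _)

theorem exists_norm_sub_saddle_eq (s : Fin 3 → ℝ) : ∃ i, ‖s - saddle i‖ = saddleDist s := by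
  obtain ⟨-, ⟨i, rfl⟩, hi⟩ :=
    (Set.finite_range saddle).isCompact.exists_infDist_eq_dist (Set.range_nonempty _) s
  exact ⟨i, ((dist_eq_norm _ _).symm.trans hi.symm)⟩

theorem saddleDist_le_one {s : Fin 3 → ℝ} (hs : s ∈ stdSimplex ℝ (Fin 3)) : saddleDist s ≤ 1 := by
  refine (saddleDist_le s 0).trans ?_
  rw [← dist_eq_norm, dist_pi_le_iff zero_le_one]
  exact fun k => Real.dist_le_of_mem_Icc_01 (mem_Icc_of_mem_stdSimplex hs k)
    (mem_Icc_of_mem_stdSimplex (saddle_mem_stdSimplex 0) k)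

theorem centreDist_centre (j : Fin 4) : centreDist (centre j) = 0 := by
  refine le_antisymm ?_ (by unfold centreDist triDist; positivity)
  have h : triDist (centre j) (centre j) = 0 := by simp [triDist]
  rw [← h]
  unfold centreDist
  fin_cases j <;> simp

theorem continuous_centreDist : Continuous centreDist := by
  unfold centreDist triDist
  fun_prop

theorem driftSq_pos {s : Fin 3 → ℝ} (hs : ∑ k, s k = 1) (hcentre : 0 < centreDist s)
    (hsaddle : 0 < saddleDist s) : 0 < driftSq critSlope s := by
  refine (driftSq_nonneg _ s).lt_of_ne' fun h => ?_
  rcases eq_saddle_or_centre_of_drift_eq_zero hs (driftSq_eq_zero.1 h) with ⟨i, rfl⟩ | ⟨j, rfl⟩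
  · exact hsaddle.not_ge ((saddleDist_le _ i).trans_eq (by rw [sub_self, norm_zero]))
  · exact hcentre.ne' (centreDist_centre j)

theorem exists_mul_sq_saddleDist_le_driftSq {a : ℝ} (ha : 0 < a) :
    ∃ c > 0, ∀ s ∈ stdSimplex ℝ (Fin 3), a ≤ centreDist s →
      c * saddleDist s ^ 2 ≤ driftSq critSlope s := by
  obtain ⟨r, hr, hnear⟩ := exists_norm_sub_saddle_le_driftSq
  have hcompact :
      IsCompact (stdSimplex ℝ (Fin 3) ∩ ({s | a ≤ centreDist s} ∩ {s | r ≤ saddleDist s})) :=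
    (isCompact_stdSimplex ℝ (Fin 3)).inter_right
      ((isClosed_le continuous_const continuous_centreDist).inter
        (isClosed_le continuous_const (Metric.continuous_infDist_pt _)))
  obtain ⟨m, hm, hfar⟩ := hcompact.exists_forall_le' (continuous_driftSq critSlope).continuousOn
    fun s hs => driftSq_pos hs.1.2 (ha.trans_le hs.2.1) (hr.trans_le hs.2.2)
  refine ⟨min m (1 / 10 ^ 6), by positivity, fun s hs hcentre => ?_⟩
  rcases le_total r (saddleDist s) with hsaddle | hsaddle
  · calc min m (1 / 10 ^ 6) * saddleDist s ^ 2 ≤ m * 1 :=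
          mul_le_mul (min_le_left _ _) (pow_le_one₀ (saddleDist_nonneg s) (saddleDist_le_one hs))
            (sq_nonneg _) hm.le
      _ ≤ driftSq critSlope s := (mul_one m).trans_le (hfar s ⟨hs, hcentre, hsaddle⟩)
  · obtain ⟨i, hi⟩ := exists_norm_sub_saddle_eq s
    have h := hnear i s hs.2 (hi.trans_le hsaddle)
    rw [hi] at h
    calc min m (1 / 10 ^ 6) * saddleDist s ^ 2 ≤ 1 / 10 ^ 6 * saddleDist s ^ 2 := by
          gcongr; exact min_le_right _ _
      _ = (saddleDist s / 1000) ^ 2 := by ring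
      _ ≤ driftSq critSlope s := h

end Saddles

/-! ### A bump which penalises the saddles -/

section Bump

/-- A bump on the simplex which is largest, with value `e ^ 2`, where the largest coordinate is
`1 / 2`. Near `saddle i` it is a function of the unstable coordinate `s i` alone, because the norm
of `Fin 3 → ℝ` is the supremum norm. -/
def bump (e : ℝ) (s : Fin 3 → ℝ) : ℝ := e ^ 4 / (e ^ 2 + (‖s‖ - 1 / 2) ^ 2)

variable {e : ℝ}

theorem lorentz_sub (he : 0 < e) (x y : ℝ) :
    e ^ 4 / (e ^ 2 + y ^ 2) - e ^ 4 / (e ^ 2 + x ^ 2) =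
      -(e ^ 4 / ((e ^ 2 + x ^ 2) * (e ^ 2 + y ^ 2)) * (y ^ 2 - x ^ 2)) := by
  field_simp
  ring

theorem abs_lorentz_sub_le_abs_sq_sub (he : 0 < e) (x y : ℝ) :
    |e ^ 4 / (e ^ 2 + y ^ 2) - e ^ 4 / (e ^ 2 + x ^ 2)| ≤ |y ^ 2 - x ^ 2| := by
  rw [lorentz_sub he, abs_neg, abs_mul, abs_of_pos (by positivity)]
  refine mul_le_of_le_one_left (abs_nonneg _) (div_le_one_of_le₀ ?_ (by positivity))
  have : 0 ≤ e ^ 2 * x ^ 2 + e ^ 2 * y ^ 2 + x ^ 2 * y ^ 2 := by positivity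
  linarith

theorem abs_lorentz_sub_le_mul (he : 0 < e) (x y : ℝ) :
    |e ^ 4 / (e ^ 2 + y ^ 2) - e ^ 4 / (e ^ 2 + x ^ 2)| ≤ e * |y - x| := by
  have hsum : |y + x| ≤ |y| + |x| := abs_add_le y x
  have hx : 2 * e * |x| ≤ e ^ 2 + x ^ 2 := by
    rw [← sq_abs x]; exact two_mul_le_add_sq e |x|
  have hy : 2 * e * |y| ≤ e ^ 2 + y ^ 2 := by
    rw [← sq_abs y]; exact two_mul_le_add_sq e |y|
  have hslope : e ^ 3 * |y + x| ≤ (e ^ 2 + x ^ 2) * (e ^ 2 + y ^ 2) := by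
    have : 0 ≤ x ^ 2 * y ^ 2 := by positivity
    nlinarith [mul_le_mul_of_nonneg_left hsum (pow_pos he 3).le,
      mul_le_mul_of_nonneg_left hx (sq_nonneg e), mul_le_mul_of_nonneg_left hy (sq_nonneg e)]
  rw [lorentz_sub he, abs_neg, abs_mul, abs_of_pos (by positivity), sq_sub_sq, abs_mul,
    div_mul_eq_mul_div, div_le_iff₀ (by positivity)]
  calc e ^ 4 * (|y + x| * |y - x|) = e * |y - x| * (e ^ 3 * |y + x|) := by ring
    _ ≤ e * |y - x| * ((e ^ 2 + x ^ 2) * (e ^ 2 + y ^ 2)) := by gcongr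

theorem lorentz_add_sub_le (he : 0 < e) (x y : ℝ) :
    e ^ 4 / (e ^ 2 + (x + y) ^ 2) - e ^ 4 / (e ^ 2 + x ^ 2) ≤
      -((e ^ 2 / (e ^ 2 + x ^ 2)) ^ 2 * (2 * x * y + y ^ 2)) + (2 * x * y + y ^ 2) ^ 2 / e ^ 2 := by
  have hremainder : e ^ 4 / (e ^ 2 + (x + y) ^ 2) - e ^ 4 / (e ^ 2 + x ^ 2) =
      -((e ^ 2 / (e ^ 2 + x ^ 2)) ^ 2 * (2 * x * y + y ^ 2)) +
        (2 * x * y + y ^ 2) ^ 2 * ((e ^ 2 / (e ^ 2 + x ^ 2)) ^ 2 / (e ^ 2 + (x + y) ^ 2)) := by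
    field_simp
    ring
  have hle_one : (e ^ 2 / (e ^ 2 + x ^ 2)) ^ 2 ≤ 1 :=
    pow_le_one₀ (by positivity) (div_le_one_of_le₀ (by linarith [sq_nonneg x]) (by positivity))
  have hle_inv : (e ^ 2 / (e ^ 2 + x ^ 2)) ^ 2 / (e ^ 2 + (x + y) ^ 2) ≤ 1 / e ^ 2 :=
    div_le_div₀ zero_le_one hle_one (by positivity) (by linarith [sq_nonneg (x + y)])
  rw [hremainder, div_eq_mul_one_div ((2 * x * y + y ^ 2) ^ 2)]
  gcongr

theorem abs_norm_sub_half_le_saddleDist (s : Fin 3 → ℝ) : |‖s‖ - 1 / 2| ≤ saddleDist s := by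
  obtain ⟨i, hi⟩ := exists_norm_sub_saddle_eq s
  rw [← hi, ← norm_saddle i]
  exact abs_norm_sub_norm_le s (saddle i)

theorem abs_bump_sub_le (he : 0 < e) (s t : Fin 3 → ℝ) :
    |bump e t - bump e s| ≤ 2 * (saddleDist s * ‖t - s‖) + ‖t - s‖ ^ 2 := by
  refine (abs_lorentz_sub_le_abs_sq_sub he _ _).trans ?_
  have hts := abs_norm_sub_norm_le t s
  have hs := abs_norm_sub_half_le_saddleDist s
  have hsum : |(‖t‖ - 1 / 2) + (‖s‖ - 1 / 2)| ≤ ‖t - s‖ + 2 * saddleDist s := by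
    rw [show (‖t‖ - 1 / 2) + (‖s‖ - 1 / 2) = (‖t‖ - ‖s‖) + 2 * (‖s‖ - 1 / 2) by ring]
    refine (abs_add_le _ _).trans ?_
    rw [abs_mul, abs_two]
    gcongr
  rw [sq_sub_sq, abs_mul, sub_sub_sub_cancel_right]
  exact (mul_le_mul hsum hts (abs_nonneg _) ((abs_nonneg _).trans hsum)).trans_eq (by ring)

theorem abs_bump_sub_le_mul (he : 0 < e) (s t : Fin 3 → ℝ) :
    |bump e t - bump e s| ≤ e * ‖t - s‖ := by
  refine (abs_lorentz_sub_le_mul he _ _).trans ?_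
  rw [sub_sub_sub_cancel_right]
  gcongr
  exact abs_norm_sub_norm_le t s

theorem abs_sub_half_le_norm_sub_saddle (s : Fin 3 → ℝ) (i : Fin 3) :
    |s i - 1 / 2| ≤ ‖s - saddle i‖ := by
  simpa only [Pi.sub_apply, saddle, if_true, Real.norm_eq_abs]
    using norm_le_pi_norm (s - saddle i) i

theorem norm_eq_of_norm_sub_saddle_le {s : Fin 3 → ℝ} (hs : s ∈ stdSimplex ℝ (Fin 3)) {i : Fin 3}
    (hi : ‖s - saddle i‖ ≤ 1 / 8) : ‖s‖ = s i := by
  have hcoord (k : Fin 3) : |s k - saddle i k| ≤ 1 / 8 :=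
    (norm_le_pi_norm (s - saddle i) k).trans hi
  refine le_antisymm ((pi_norm_le_iff_of_nonneg (hs.1 i)).2 fun k => ?_)
    ((le_abs_self _).trans (norm_le_pi_norm s i))
  rw [Real.norm_eq_abs, abs_of_nonneg (hs.1 k)]
  rcases eq_or_ne k i with rfl | hk
  · exact le_rfl
  · have hki := (abs_le.1 (hcoord k)).2
    have hii := (abs_le.1 (hcoord i)).1
    simp only [saddle, if_neg hk, if_true] at hki hii
    linarith

variable {L δ κ : ℝ} {s : Fin 3 → ℝ} {ι : Type*} [Fintype ι] {w : ι → ℝ} {v : ι → Fin 3 → ℝ}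

theorem IsStep.norm_smul_le (h : IsStep L δ s w v) (hδ : 0 ≤ δ) (j : ι) : ‖δ • v j‖ ≤ δ := by
  rw [norm_smul, Real.norm_of_nonneg hδ]
  exact mul_le_of_le_one_right hδ ((pi_norm_le_iff_of_nonneg zero_le_one).2 (h.abs_le_one j))

theorem IsStep.wmean_le (h : IsStep L δ s w v) {f : ι → ℝ} {b : ℝ} (hf : ∀ j, f j ≤ b) :
    wmean w f ≤ b :=
  (wmean_mono h.nonneg hf).trans_eq (wmean_const h.sum_one b)

theorem IsStep.bump_sub_le (h : IsStep L δ s w v) (he : 0 < e) (hδ : 0 ≤ δ) (hδ1 : δ ≤ 1 / 16)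
    {i : Fin 3} (hi : ‖s - saddle i‖ ≤ 1 / 16) (j : ι) :
    bump e (s + δ • v j) - bump e s ≤
      -(e ^ 2 / (e ^ 2 + (s i - 1 / 2) ^ 2)) ^ 2 *
        (2 * δ * (s i - 1 / 2) * v j i + δ ^ 2 * v j i ^ 2) +
      (8 * δ ^ 2 * ‖s - saddle i‖ ^ 2 + 2 * δ ^ 4) / e ^ 2 := by
  have hnorm_s : ‖s‖ = s i := norm_eq_of_norm_sub_saddle_le h.mem (hi.trans (by norm_num))
  have hnorm_add : ‖s + δ • v j‖ = s i + δ * v j i := by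
    refine norm_eq_of_norm_sub_saddle_le (h.mem_add j) ?_
    rw [add_sub_right_comm]
    exact (norm_add_le _ _).trans (by linarith [h.norm_smul_le hδ j])
  have hx : (s i - 1 / 2) ^ 2 ≤ ‖s - saddle i‖ ^ 2 :=
    sq_le_sq.2 ((abs_sub_half_le_norm_sub_saddle s i).trans (le_abs_self _))
  have hv : v j i ^ 2 ≤ 1 := (sq_le_one_iff_abs_le_one _).2 (h.abs_le_one j i)
  have hbump := lorentz_add_sub_le he (s i - 1 / 2) (δ * v j i)
  rw [bump, bump, hnorm_s, hnorm_add, add_sub_right_comm]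
  refine hbump.trans (add_le_add (le_of_eq (by ring)) ?_)
  gcongr
  calc (2 * (s i - 1 / 2) * (δ * v j i) + (δ * v j i) ^ 2) ^ 2
      ≤ 2 * ((2 * (s i - 1 / 2) * (δ * v j i)) ^ 2 + ((δ * v j i) ^ 2) ^ 2) := add_sq_le
    _ = 8 * δ ^ 2 * ((s i - 1 / 2) ^ 2 * v j i ^ 2) + 2 * δ ^ 4 * (v j i ^ 2) ^ 2 := by ring
    _ ≤ 8 * δ ^ 2 * (‖s - saddle i‖ ^ 2 * 1) + 2 * δ ^ 4 * 1 ^ 2 := by gcongr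
    _ = _ := by ring

theorem IsStep.wmean_bump_sub_le_of_near (h : IsStep L δ s w v) (he : 0 < e) (hδ : 0 ≤ δ)
    (hδ1 : δ ≤ 1 / 16) {i : Fin 3} (hi : ‖s - saddle i‖ ≤ 1 / 16)
    (hunstable : -(κ * ‖s - saddle i‖ ^ 2) ≤ (s i - 1 / 2) * drift critSlope s i) :
    wmean w (fun j => bump e (s + δ • v j) - bump e s) ≤
      (e ^ 2 / (e ^ 2 + (s i - 1 / 2) ^ 2)) ^ 2 * (2 * κ * δ * ‖s - saddle i‖ ^ 2 +
        2 * L * δ ^ 2 * ‖s - saddle i‖ - δ ^ 2 / 48) +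
      (8 * δ ^ 2 * ‖s - saddle i‖ ^ 2 + 2 * δ ^ 4) / e ^ 2 := by
  have hmean : -(‖s - saddle i‖ * (L * δ)) ≤
      (s i - 1 / 2) * (wmean w (fun j => v j i) - drift critSlope s i) := by
    refine (abs_le.1 ?_).1
    rw [abs_mul]
    exact mul_le_mul (abs_sub_half_le_norm_sub_saddle s i) (h.mean i) (abs_nonneg _) (norm_nonneg _)
  have hincr : -(2 * δ * (s i - 1 / 2) * wmean w (fun j => v j i) +
      δ ^ 2 * wmean w fun j => v j i ^ 2) ≤
      2 * κ * δ * ‖s - saddle i‖ ^ 2 + 2 * L * δ ^ 2 * ‖s - saddle i‖ - δ ^ 2 / 48 := by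
    linarith [mul_le_mul_of_nonneg_left (h.var i) (sq_nonneg δ),
      mul_le_mul_of_nonneg_left (add_le_add hmean hunstable) (mul_nonneg zero_le_two hδ)]
  refine (wmean_mono h.nonneg (h.bump_sub_le he hδ hδ1 hi)).trans ?_
  rw [wmean_add, wmean_const h.sum_one, wmean_mul, wmean_add, wmean_mul, wmean_mul, neg_mul,
    ← mul_neg]
  gcongr

theorem IsStep.wmean_bump_sub_le_add (h : IsStep L δ s w v) (hL : 0 ≤ L) (he : 0 < e)
    (hκ : 0 ≤ κ) (hδ : 0 ≤ δ) (hδ1 : δ ≤ 1 / 16) {i : Fin 3} (hi : ‖s - saddle i‖ ≤ 1 / 16)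
    (hunstable : -(κ * ‖s - saddle i‖ ^ 2) ≤ (s i - 1 / 2) * drift critSlope s i) :
    wmean w (fun j => bump e (s + δ • v j) - bump e s) ≤
      2 * κ * δ * ‖s - saddle i‖ ^ 2 + (2 * L + 10 / e ^ 2) * δ ^ 2 := by
  have hd := norm_nonneg (s - saddle i)
  refine (h.wmean_bump_sub_le_of_near he hδ hδ1 hi hunstable).trans ?_
  generalize ‖s - saddle i‖ = d at *
  have hle_one : (e ^ 2 / (e ^ 2 + (s i - 1 / 2) ^ 2)) ^ 2 ≤ 1 := pow_le_one₀ (by positivity)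
    (div_le_one_of_le₀ (by linarith [sq_nonneg (s i - 1 / 2)]) (by positivity))
  have hmain : 2 * κ * δ * d ^ 2 + 2 * L * δ ^ 2 * d - δ ^ 2 / 48 ≤
      2 * κ * δ * d ^ 2 + 2 * L * δ ^ 2 * 1 := by
    refine (sub_le_self _ (by positivity)).trans ?_
    gcongr
    linarith
  have hrest : (8 * δ ^ 2 * d ^ 2 + 2 * δ ^ 4) / e ^ 2 ≤ 10 * δ ^ 2 / e ^ 2 := by
    gcongr
    have hd1 : d ^ 2 ≤ 1 := pow_le_one₀ hd (by linarith)
    have hδ2 : δ ^ 2 ≤ 1 := pow_le_one₀ hδ (by linarith)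
    linarith [mul_le_mul_of_nonneg_left (add_le_add hd1 hδ2) (sq_nonneg δ),
      mul_le_mul_of_nonneg_left hd1 (sq_nonneg δ)]
  calc _ ≤ 1 * (2 * κ * δ * d ^ 2 + 2 * L * δ ^ 2 * 1) + 10 * δ ^ 2 / e ^ 2 := by
        refine add_le_add ((mul_le_mul_of_nonneg_left hmain (sq_nonneg _)).trans ?_) hrest
        gcongr
    _ = _ := by ring

theorem IsStep.wmean_bump_sub_le_sub (h : IsStep L δ s w v) (hL : 0 < L) (he : 0 < e)
    (hκ : 0 ≤ κ) (hδ : 0 ≤ δ) (hδ1 : δ ≤ 1 / 16) (hδe : δ ≤ e / 96) {i : Fin 3}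
    (hi : ‖s - saddle i‖ ≤ 1 / 16) (hie : ‖s - saddle i‖ ≤ e / 96)
    (hiL : ‖s - saddle i‖ ≤ 1 / (384 * L))
    (hunstable : -(κ * ‖s - saddle i‖ ^ 2) ≤ (s i - 1 / 2) * drift critSlope s i) :
    wmean w (fun j => bump e (s + δ • v j) - bump e s) ≤
      2 * κ * δ * ‖s - saddle i‖ ^ 2 - δ ^ 2 / 192 := by
  have hx := abs_sub_half_le_norm_sub_saddle s i
  have hd := norm_nonneg (s - saddle i)
  refine (h.wmean_bump_sub_le_of_near he hδ hδ1 hi hunstable).trans ?_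
  generalize ‖s - saddle i‖ = d at *
  generalize s i - 1 / 2 = x at *
  have hx2 : x ^ 2 ≤ (e / 96) ^ 2 := by
    rw [← sq_abs]
    exact pow_le_pow_left₀ (abs_nonneg x) (hx.trans hie) 2
  have hpeak : (e ^ 2 / (e ^ 2 + x ^ 2)) ^ 2 ∈ Set.Icc (1 / 2) 1 := by
    have hfrac : 3 / 4 ≤ e ^ 2 / (e ^ 2 + x ^ 2) := by
      rw [le_div_iff₀ (by positivity)]
      nlinarith
    refine ⟨by nlinarith, pow_le_one₀ (by positivity) (div_le_one_of_le₀ ?_ (by positivity))⟩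
    linarith [sq_nonneg x]
  have hLd : 2 * L * δ ^ 2 * d ≤ δ ^ 2 / 192 := by
    rw [le_div_iff₀ (by positivity)] at hiL
    nlinarith [mul_le_mul_of_nonneg_left hiL (sq_nonneg δ)]
  have hrest : (8 * δ ^ 2 * d ^ 2 + 2 * δ ^ 4) / e ^ 2 ≤ δ ^ 2 / 768 := by
    rw [div_le_iff₀ (by positivity)]
    nlinarith [mul_le_mul_of_nonneg_left (pow_le_pow_left₀ hd hie 2) (sq_nonneg δ),
      mul_le_mul_of_nonneg_left (pow_le_pow_left₀ hδ hδe 2) (sq_nonneg δ),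
      mul_nonneg (sq_nonneg δ) (sq_nonneg e)]
  generalize (e ^ 2 / (e ^ 2 + x ^ 2)) ^ 2 = p at *
  have hκd : p * (κ * δ * d ^ 2) ≤ 1 * (κ * δ * d ^ 2) := by
    gcongr
    exact hpeak.2
  nlinarith [hpeak.1, sq_nonneg δ, mul_le_mul_of_nonneg_left hLd (by linarith [hpeak.1] : 0 ≤ p),
    mul_le_mul_of_nonneg_right hpeak.1 (sq_nonneg δ)]

theorem exists_wmean_bump_sub_le (hL : 0 < L) (hκ : 0 < κ) : ∃ e > 0, ∃ r > 0, ∃ K > 0,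
    ∀ {δ : ℝ} {s : Fin 3 → ℝ} {ι : Type} [Fintype ι] {w : ι → ℝ} {v : ι → Fin 3 → ℝ},
      IsStep L δ s w v → 0 ≤ δ → δ ≤ r →
      wmean w (fun j => bump e (s + δ • v j) - bump e s) ≤
        κ * δ * saddleDist s ^ 2 + K * δ ^ 2 ∧
      (saddleDist s ≤ r → wmean w (fun j => bump e (s + δ • v j) - bump e s) ≤
        κ * δ * saddleDist s ^ 2 - δ ^ 2 / 192) := by
  obtain ⟨r₀, hr₀, hunstable⟩ := exists_unstable_radius (half_pos hκ)
  obtain ⟨r₁, hr₁, hr₁₀, hr₁'⟩ : ∃ r₁ > 0, r₁ ≤ r₀ ∧ r₁ ≤ 1 / 16 :=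
    ⟨min r₀ (1 / 16), by positivity, min_le_left _ _, min_le_right _ _⟩
  obtain ⟨e, he, he'⟩ : ∃ e > 0, e = κ * r₁ ^ 2 := ⟨_, by positivity, rfl⟩
  refine ⟨e, he, min r₁ (min (e / 96) (1 / (384 * L))), by positivity, 2 * L + 10 / e ^ 2,
    by positivity, fun {δ s ι _ w v} h hδ hδr => ?_⟩
  obtain ⟨i, hi⟩ := exists_norm_sub_saddle_eq s
  obtain ⟨hδr₁, hδe, -⟩ : δ ≤ r₁ ∧ δ ≤ e / 96 ∧ δ ≤ 1 / (384 * L) := by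
    simpa only [le_min_iff] using hδr
  have hδ1 : δ ≤ 1 / 16 := hδr₁.trans hr₁'
  rw [← hi]
  constructor
  · rcases le_total ‖s - saddle i‖ r₁ with hnear | hfar
    · exact (h.wmean_bump_sub_le_add hL.le he (half_pos hκ).le hδ hδ1 (hnear.trans hr₁')
        (hunstable i s h.mem.2 (hnear.trans hr₁₀))).trans_eq (by ring)
    · have hstep (j : ι) : bump e (s + δ • v j) - bump e s ≤ e * δ := by
        refine (le_abs_self _).trans ((abs_bump_sub_le_mul he s _).trans ?_)
        rw [add_sub_cancel_left]
        exact mul_le_mul_of_nonneg_left (h.norm_smul_le hδ j) he.le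
      calc _ ≤ κ * δ * r₁ ^ 2 := (h.wmean_le hstep).trans_eq (by rw [he']; ring)
        _ ≤ κ * δ * ‖s - saddle i‖ ^ 2 := by gcongr
        _ ≤ _ := le_add_of_nonneg_right (by positivity)
  · intro hd
    obtain ⟨hdr₁, hde, hdL⟩ : ‖s - saddle i‖ ≤ r₁ ∧ ‖s - saddle i‖ ≤ e / 96 ∧
        ‖s - saddle i‖ ≤ 1 / (384 * L) := by simpa only [le_min_iff] using hd
    exact (h.wmean_bump_sub_le_sub hL he (half_pos hκ).le hδ hδ1 hδe (hdr₁.trans hr₁') hde hdL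
      (hunstable i s h.mem.2 (hdr₁.trans hr₁₀))).trans_eq (by ring)

end Bump

/-! ### The profile -/

section Profile

variable {A L δ e : ℝ} {s : Fin 3 → ℝ} {ι : Type*} [Fintype ι] {w : ι → ℝ} {v : ι → Fin 3 → ℝ}

theorem IsStep.wmean_potential_sub_le (h : IsStep L δ s w v) (hδ : 0 ≤ δ) :
    wmean w (fun j => potential critSlope (s + δ • v j) - potential critSlope s) ≤
      -(critSlope * δ * driftSq critSlope s) + critSlope * (3 * L + 3 / 2) * δ ^ 2 := by
  have hstep (j : ι) : potential critSlope (s + δ • v j) - potential critSlope s ≤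
      -(critSlope * δ) * (drift critSlope s 0 * v j 0 + drift critSlope s 1 * v j 1 +
        drift critSlope s 2 * v j 2) + critSlope * (3 / 2) * δ ^ 2 := by
    have hpotential := potential_add_le critSlope s (δ • v j)
    have hsq (k : Fin 3) : v j k ^ 2 ≤ 1 := (sq_le_one_iff_abs_le_one _).2 (h.abs_le_one j k)
    have hquad := mul_le_mul_of_nonneg_left (add_le_add_three (hsq 0) (hsq 1) (hsq 2))
      (mul_nonneg critSlope_pos.le (sq_nonneg δ))
    simp only [Fin.sum_univ_three, Pi.smul_apply, smul_eq_mul] at hpotential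
    linarith
  have hcoord (k : Fin 3) : drift critSlope s k ^ 2 - L * δ ≤
      drift critSlope s k * wmean w fun j => v j k := by
    have herror : |drift critSlope s k * (wmean w (fun j => v j k) - drift critSlope s k)| ≤
        1 * (L * δ) := by
      rw [abs_mul]
      exact mul_le_mul (abs_drift_le_one h.mem k) (h.mean k) (abs_nonneg _) zero_le_one
    linarith [(abs_le.1 herror).1]
  have hmean := mul_le_mul_of_nonneg_left
    (add_le_add_three (hcoord 0) (hcoord 1) (hcoord 2)) (mul_nonneg critSlope_pos.le hδ)
  refine (wmean_mono h.nonneg hstep).trans ?_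
  rw [wmean_add, wmean_const h.sum_one, wmean_mul, wmean_add, wmean_add, wmean_mul, wmean_mul,
    wmean_mul, driftSq, Fin.sum_univ_three]
  linarith

/-- The mean-field free energy raised by a multiple of the bump at the saddles: unlike the free
energy, it also decreases on average when the chain is at a saddle. -/
def profile (A e : ℝ) (s : Fin 3 → ℝ) : ℝ := potential critSlope s + A * bump e s

theorem profile_sub (A e : ℝ) (s t : Fin 3 → ℝ) : profile A e t - profile A e s =
    (potential critSlope t - potential critSlope s) + A * (bump e t - bump e s) := by
  unfold profile
  ring

theorem IsStep.wmean_profile_sub_le (h : IsStep L δ s w v) (hA : 0 ≤ A) (hδ : 0 ≤ δ) {b : ℝ}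
    (hb : wmean w (fun j => bump e (s + δ • v j) - bump e s) ≤ b) :
    wmean w (fun j => profile A e (s + δ • v j) - profile A e s) ≤
      -(critSlope * δ * driftSq critSlope s) + critSlope * (3 * L + 3 / 2) * δ ^ 2 + A * b := by
  simp only [profile_sub]
  rw [wmean_add, wmean_mul]
  gcongr
  exact h.wmean_potential_sub_le hδ

theorem exists_wmean_profile_sub_le {a : ℝ} (ha : 0 < a) (hL : 0 < L) :
    ∃ A > 0, ∃ e > 0, ∃ c > 0, ∃ δ₀ > 0, ∀ {δ : ℝ} {s : Fin 3 → ℝ} {ι : Type} [Fintype ι]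
      {w : ι → ℝ} {v : ι → Fin 3 → ℝ}, IsStep L δ s w v → 0 ≤ δ → δ ≤ δ₀ → a ≤ centreDist s →
      wmean w (fun j => profile A e (s + δ • v j) - profile A e s) ≤
        -(c * (δ * driftSq critSlope s + δ ^ 2)) := by
  have hβ := critSlope_pos
  obtain ⟨c₀, hc₀, hdrift⟩ := exists_mul_sq_saddleDist_le_driftSq ha
  obtain ⟨C, hC, hC'⟩ : ∃ C > 0, critSlope * (3 * L + 3 / 2) = C := ⟨_, by positivity, rfl⟩
  obtain ⟨e, he, r, hr, K, hK, hbump⟩ :=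
    exists_wmean_bump_sub_le hL (κ := critSlope * c₀ / (768 * C)) (by positivity)
  let c := min (critSlope / 4) C
  have hc : 0 < c := by positivity
  refine ⟨384 * C, by positivity, e, he, c, hc,
    min r (critSlope / 4 * (c₀ * r ^ 2) / (C + 384 * C * K + c)), by positivity, ?_⟩
  intro δ s ι _ w v h hδ hδ₀ hcentre
  obtain ⟨hadd, hsub⟩ := hbump h hδ (hδ₀.trans (min_le_left _ _))
  replace hdrift := hdrift s h.mem hcentre
  have hdδ : 384 * C * (critSlope * c₀ / (768 * C) * δ * saddleDist s ^ 2) ≤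
      critSlope / 2 * δ * driftSq critSlope s := by
    calc _ = critSlope / 2 * δ * (c₀ * saddleDist s ^ 2) := by field_simp; ring
      _ ≤ _ := by gcongr
  have hcβ : c * (δ * driftSq critSlope s) ≤ critSlope / 4 * (δ * driftSq critSlope s) :=
    mul_le_mul_of_nonneg_right (min_le_left _ _) (mul_nonneg hδ (driftSq_nonneg _ s))
  have hcC : c * δ ^ 2 ≤ C * δ ^ 2 := mul_le_mul_of_nonneg_right (min_le_right _ _) (sq_nonneg δ)
  rcases le_total (saddleDist s) r with hnear | hfar
  · have hprofile := h.wmean_profile_sub_le (A := 384 * C) (by positivity) hδ (hsub hnear)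
    rw [hC'] at hprofile
    linarith [mul_nonneg (mul_nonneg hβ.le hδ) (driftSq_nonneg critSlope s)]
  · have hprofile := h.wmean_profile_sub_le (A := 384 * C) (by positivity) hδ hadd
    rw [hC'] at hprofile
    have hr_drift : c₀ * r ^ 2 ≤ driftSq critSlope s := le_trans (by gcongr) hdrift
    have hδ_small := hδ₀.trans (min_le_right _ _)
    rw [le_div_iff₀ (by positivity)] at hδ_small
    linarith [mul_le_mul_of_nonneg_left hδ_small hδ,
      mul_le_mul_of_nonneg_left hr_drift (by positivity : 0 ≤ critSlope / 4 * δ)]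

theorem exists_abs_profile_sub_le (hA : 0 ≤ A) (he : 0 < e) {c₀ : ℝ} (hc₀ : 0 < c₀) :
    ∃ B > 0, ∀ s ∈ stdSimplex ℝ (Fin 3), c₀ * saddleDist s ^ 2 ≤ driftSq critSlope s →
      ∀ t ∈ stdSimplex ℝ (Fin 3), |profile A e t - profile A e s| ≤
        B * (√(driftSq critSlope s) * ‖t - s‖ + ‖t - s‖ ^ 2) := by
  have hnorm {s : Fin 3 → ℝ} (hs : s ∈ stdSimplex ℝ (Fin 3)) : ‖s‖ ≤ 1 :=
    (pi_norm_le_iff_of_nonneg zero_le_one).2 fun k => by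
      rw [Real.norm_of_nonneg (hs.1 k)]
      exact (mem_Icc_of_mem_stdSimplex hs k).2
  obtain ⟨D, hD, hpotential⟩ := exists_abs_potential_sub_le (ι := Fin 3) critSlope_pos.le 1
  refine ⟨D + A * (2 / √c₀ + 1), by positivity, fun s hs hdrift t ht => ?_⟩
  have hsaddle : saddleDist s ≤ √(driftSq critSlope s) / √c₀ := by
    rw [le_div_iff₀ (by positivity), ← Real.sqrt_sq (saddleDist_nonneg s),
      ← Real.sqrt_mul (sq_nonneg _), mul_comm]
    exact Real.sqrt_le_sqrt hdrift
  have hbump : |bump e t - bump e s| ≤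
      (2 / √c₀ + 1) * (√(driftSq critSlope s) * ‖t - s‖ + ‖t - s‖ ^ 2) := by
    calc |bump e t - bump e s| ≤ 2 * (saddleDist s * ‖t - s‖) + ‖t - s‖ ^ 2 :=
          abs_bump_sub_le he s t
      _ ≤ 2 * (√(driftSq critSlope s) / √c₀ * ‖t - s‖) + ‖t - s‖ ^ 2 := by gcongr
      _ ≤ 2 * (√(driftSq critSlope s) / √c₀ * ‖t - s‖) + ‖t - s‖ ^ 2 +
          (√(driftSq critSlope s) * ‖t - s‖ + 2 / √c₀ * ‖t - s‖ ^ 2) :=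
        le_add_of_nonneg_right (by positivity)
      _ = _ := by ring
  have hA_bump := mul_le_mul_of_nonneg_left hbump hA
  rw [← abs_of_nonneg hA, ← abs_mul, abs_of_nonneg hA] at hA_bump
  rw [profile_sub]
  refine (abs_add_le _ _).trans ?_
  linarith [hpotential s t (hnorm hs) (hnorm ht)]

end Profile

theorem profile_saddle (A e : ℝ) (i j : Fin 3) :
    profile A e (saddle i) = profile A e (saddle j) := by
  rw [profile, profile, bump, bump, norm_saddle, norm_saddle, potential_saddle i j]

theorem exists_abs_profile_sub_saddle_le {A e : ℝ} (hA : 0 ≤ A) (he : 0 < e) :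
    ∃ B > 0, ∀ s ∈ stdSimplex ℝ (Fin 3), ∀ i,
      |profile A e s - profile A e (saddle i)| ≤ B * saddleDist s ^ 2 := by
  obtain ⟨B, hB, hprofile⟩ := exists_abs_profile_sub_le hA he one_pos
  refine ⟨B, hB, fun s hs i => ?_⟩
  obtain ⟨j, hj⟩ := exists_norm_sub_saddle_eq s
  have hdist : saddleDist (saddle j) = 0 :=
    Metric.infDist_zero_of_mem (Set.mem_range_self j)
  have hdrift : driftSq critSlope (saddle j) = 0 :=
    driftSq_eq_zero.2 fun k => by rw [drift, softmax_saddle, sub_self]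
  have h := hprofile (saddle j) (saddle_mem_stdSimplex j) (by rw [hdist, hdrift]; norm_num) s hs
  rwa [hdrift, Real.sqrt_zero, zero_mul, zero_add, hj, profile_saddle A e j i] at h

/-! ### The Lyapunov function -/

section Arsinh

theorem sqrt_one_add_sq_le (x y : ℝ) : √(1 + y ^ 2) ≤ √(1 + x ^ 2) + |y - x| := by
  have hx : x * (y - x) ≤ √(1 + x ^ 2) * |y - x| := by
    refine (le_abs_self _).trans ?_
    rw [abs_mul]
    gcongr
    exact Real.abs_le_sqrt (by linarith)
  have hsqrt := Real.sq_sqrt (by positivity : 0 ≤ 1 + x ^ 2)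
  rw [Real.sqrt_le_left (by positivity)]
  linarith [sq_abs (y - x)]

theorem sqrt_one_add_sq_div_le {u K δ n : ℝ} (hK : 0 < K) (hδ : 0 < δ) (hu : |u| ≤ K * n) :
    √(1 + (u / (K * δ)) ^ 2) ≤ (n + δ) / δ := by
  have hle := sqrt_one_add_sq_le 0 (u / (K * δ))
  rw [zero_pow two_ne_zero, add_zero, Real.sqrt_one, sub_zero, abs_div,
    abs_of_pos (by positivity : 0 < K * δ)] at hle
  have hu' : |u| / (K * δ) ≤ n / δ := by
    rw [div_le_div_iff₀ (by positivity) hδ, ← mul_assoc, mul_comm n K]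
    gcongr
  rw [add_div, div_self hδ.ne', add_comm (n / δ)]
  exact hle.trans (by gcongr)

theorem abs_inv_sqrt_one_add_sq_sub_le {x y d : ℝ} (hd : d ≤ 1 / 2) (hxy : |y - x| ≤ d) :
    |(√(1 + y ^ 2))⁻¹ - 1 / √(1 + x ^ 2)| ≤ 2 * d / √(1 + x ^ 2) := by
  have hx : 1 ≤ √(1 + x ^ 2) := Real.one_le_sqrt.2 (by linarith [sq_nonneg x])
  have hle := sqrt_one_add_sq_le x y
  have hge := sqrt_one_add_sq_le y x
  rw [abs_sub_comm x y] at hge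
  have hy : 1 / 2 ≤ √(1 + y ^ 2) := by linarith
  have hdiff : |√(1 + x ^ 2) - √(1 + y ^ 2)| ≤ d := by rw [abs_le]; constructor <;> linarith
  have hfrac : (√(1 + y ^ 2))⁻¹ - 1 / √(1 + x ^ 2) =
      (√(1 + x ^ 2) - √(1 + y ^ 2)) / √(1 + y ^ 2) / √(1 + x ^ 2) := by
    field_simp
  rw [hfrac, abs_div, abs_div, abs_of_pos (by positivity : 0 < √(1 + x ^ 2)),
    abs_of_pos (by positivity : 0 < √(1 + y ^ 2))]
  gcongr
  rw [div_le_iff₀ (by positivity)]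
  nlinarith [hy, (abs_nonneg _).trans hdiff]

theorem arsinh_add_sub_le {x d : ℝ} (hd : |d| ≤ 1 / 2) :
    Real.arsinh (x + d) - Real.arsinh x ≤ (d + 2 * d ^ 2) / √(1 + x ^ 2) := by
  have hderiv : ∀ y ∈ Metric.closedBall x |d|,
      HasDerivWithinAt (fun y => Real.arsinh y - y / √(1 + x ^ 2))
        ((√(1 + y ^ 2))⁻¹ - 1 / √(1 + x ^ 2)) (Metric.closedBall x |d|) y := fun y _ =>
    ((Real.hasDerivAt_arsinh y).sub ((hasDerivAt_id y).div_const _)).hasDerivWithinAt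
  have h := (convex_closedBall x |d|).norm_image_sub_le_of_norm_hasDerivWithin_le hderiv
    (fun y hy => abs_inv_sqrt_one_add_sq_sub_le hd (by rwa [← Real.dist_eq]))
    (Metric.mem_closedBall_self (abs_nonneg d)) (y := x + d)
    (by rw [Metric.mem_closedBall, Real.dist_eq, add_sub_cancel_left])
  rw [add_sub_cancel_left, Real.norm_eq_abs, Real.norm_eq_abs] at h
  have hsq : 2 * |d| / √(1 + x ^ 2) * |d| = 2 * d ^ 2 / √(1 + x ^ 2) := by
    rw [← sq_abs d]; ring
  linarith [(abs_le.1 h).2, add_div d (2 * d ^ 2) √(1 + x ^ 2), add_div x d √(1 + x ^ 2)]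

theorem abs_arsinh_le (x : ℝ) : |Real.arsinh x| ≤ Real.log (1 + 2 * |x|) := by
  have habs : |Real.arsinh x| = Real.arsinh |x| := by
    rcases le_total 0 x with hx | hx
    · rw [abs_of_nonneg hx, abs_of_nonneg (Real.arsinh_nonneg_iff.2 hx)]
    · rw [abs_of_nonpos hx, abs_of_nonpos (Real.arsinh_nonpos_iff.2 hx), Real.arsinh_neg]
  have hsqrt := sqrt_one_add_sq_le 0 |x|
  rw [zero_pow two_ne_zero, add_zero, Real.sqrt_one, sub_zero, abs_abs] at hsqrt
  rw [habs, Real.arsinh]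
  exact Real.log_le_log (by positivity) (by linarith)

theorem abs_arsinh_div_le {u K δ : ℝ} (hK : 0 < K) (hu : |u| ≤ K) (hδ : 0 < δ) (hδ' : δ ≤ 1 / 3) :
    |Real.arsinh (u / (K * δ))| ≤ 2 * Real.log (1 / δ) := by
  have hx : |u / (K * δ)| ≤ 1 / δ := by
    rw [abs_div, abs_of_pos (by positivity : 0 < K * δ), div_le_div_iff₀ (by positivity) hδ,
      one_mul]
    gcongr
  have hδ_inv : 3 ≤ 1 / δ := by rw [le_div_iff₀ hδ]; linarith
  have hlog : 2 * Real.log (1 / δ) = Real.log ((1 / δ) ^ 2) := by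
    rw [Real.log_pow, Nat.cast_ofNat]
  rw [hlog]
  exact (abs_arsinh_le _).trans (Real.log_le_log (by positivity) (by nlinarith))

variable {ι : Type*} [Fintype ι] {w d : ι → ℝ}

theorem wmean_arsinh_add_sub_le (hw0 : ∀ i, 0 ≤ w i) (hw1 : ∑ i, w i = 1) (x : ℝ) {q : ℝ}
    (hd : ∀ i, |d i| ≤ 1 / 2) (hq : ∀ i, d i ^ 2 ≤ q) :
    wmean w (fun i => Real.arsinh (x + d i) - Real.arsinh x) ≤
      (wmean w d + 2 * q) / √(1 + x ^ 2) := by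
  have hstep (i : ι) : Real.arsinh (x + d i) - Real.arsinh x ≤
      1 / √(1 + x ^ 2) * (d i + 2 * q) := by
    rw [one_div_mul_eq_div]
    refine (arsinh_add_sub_le (hd i)).trans ?_
    gcongr
    exact hq i
  refine (wmean_mono hw0 hstep).trans_eq ?_
  rw [wmean_mul, wmean_add, wmean_const hw1, one_div_mul_eq_div]

theorem wmean_arsinh_div_sub_le {B c K δ n u : ℝ} (hδ : 0 < δ) (hδ1 : δ ≤ 1) (hB : 0 < B)
    (hc : 0 < c) (hn0 : 0 ≤ n) (hn : n ≤ 3) (hK1 : 6 * B ≤ K) (hK2 : 8 * B ^ 2 ≤ c * K)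
    (hw0 : ∀ i, 0 ≤ w i) (hw1 : ∑ i, w i = 1) (hmean : wmean w d ≤ -(c * (δ * n + δ ^ 2)))
    (hd : ∀ i, |d i| ≤ B * (√n * δ + δ ^ 2)) (hu : |u| ≤ B * n) :
    wmean w (fun i => Real.arsinh ((u + d i) / (K * δ)) - Real.arsinh (u / (K * δ))) ≤
      -(c * δ / (2 * K)) := by
  have hK : 0 < K := by linarith
  have hsqrt : √n ≤ 2 := by rw [Real.sqrt_le_left (by norm_num)]; linarith
  have hd' (i : ι) : |d i / (K * δ)| ≤ B / K * (√n + δ) := by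
    rw [abs_div, abs_of_pos (by positivity : 0 < K * δ), div_le_iff₀ (by positivity)]
    exact (hd i).trans_eq (by field_simp)
  have hd_half (i : ι) : |d i / (K * δ)| ≤ 1 / 2 := by
    refine (hd' i).trans ?_
    rw [div_mul_eq_mul_div, div_le_iff₀ hK]
    nlinarith
  have hd_sq (i : ι) : (d i / (K * δ)) ^ 2 ≤ c * (n + δ) / (4 * K) := by
    calc (d i / (K * δ)) ^ 2 ≤ (B / K * (√n + δ)) ^ 2 :=
          sq_le_sq' (abs_le.1 (hd' i)).1 (abs_le.1 (hd' i)).2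
      _ ≤ (B / K) ^ 2 * (2 * (n + δ)) := by
          rw [mul_pow]
          gcongr
          nlinarith [Real.sq_sqrt hn0, sq_nonneg (√n - δ)]
      _ = 8 * B ^ 2 * ((n + δ) / (4 * K ^ 2)) := by field_simp; norm_num
      _ ≤ c * K * ((n + δ) / (4 * K ^ 2)) := by gcongr
      _ = c * (n + δ) / (4 * K) := by field_simp
  have hmean' : wmean w (fun i => d i / (K * δ)) ≤ -(c * (n + δ) / K) := by
    simp only [div_eq_inv_mul _ (K * δ)]
    rw [wmean_mul, inv_mul_le_iff₀ (by positivity)]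
    exact hmean.trans_eq (by field_simp)
  have hsqrt_x : √(1 + (u / (K * δ)) ^ 2) ≤ (n + δ) / δ :=
    sqrt_one_add_sq_div_le hK hδ (hu.trans (by gcongr; linarith))
  simp only [add_div u]
  calc _ ≤ (-(c * (n + δ) / K) + 2 * (c * (n + δ) / (4 * K))) / √(1 + (u / (K * δ)) ^ 2) :=
        (wmean_arsinh_add_sub_le hw0 hw1 _ hd_half hd_sq).trans (by gcongr)
    _ = -(c * (n + δ) / (2 * K) / √(1 + (u / (K * δ)) ^ 2)) := by ring
    _ ≤ -(c * (n + δ) / (2 * K) / ((n + δ) / δ)) := by gcongr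
    _ = -(c * δ / (2 * K)) := by field_simp

end Arsinh

/-- The estimates on `h` from which the Lyapunov function is built: outside the central region
`h` decreases on average, while its increments and its size are controlled by the drift. -/
structure IsProfile (a L B c δ₀ : ℝ) (h : (Fin 3 → ℝ) → ℝ) : Prop where
  abs_le : ∀ s ∈ stdSimplex ℝ (Fin 3), |h s| ≤ B
  abs_le_driftSq : ∀ s ∈ stdSimplex ℝ (Fin 3), a ≤ centreDist s →
    |h s| ≤ B * driftSq critSlope s
  abs_sub_le : ∀ s ∈ stdSimplex ℝ (Fin 3), a ≤ centreDist s → ∀ t ∈ stdSimplex ℝ (Fin 3),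
    |h t - h s| ≤ B * (√(driftSq critSlope s) * ‖t - s‖ + ‖t - s‖ ^ 2)
  wmean_sub_le : ∀ {δ : ℝ} {s : Fin 3 → ℝ} {ι : Type} [Fintype ι] {w : ι → ℝ}
    {v : ι → Fin 3 → ℝ}, IsStep L δ s w v → 0 ≤ δ → δ ≤ δ₀ → a ≤ centreDist s →
    wmean w (fun j => h (s + δ • v j) - h s) ≤ -(c * (δ * driftSq critSlope s + δ ^ 2))

theorem exists_isProfile {a L : ℝ} (ha : 0 < a) (hL : 0 < L) :
    ∃ B > 0, ∃ c > 0, ∃ δ₀ > 0, ∃ h, IsProfile a L B c δ₀ h := by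
  obtain ⟨A, hA, e, he, c, hc, δ₀, hδ₀, hmean⟩ := exists_wmean_profile_sub_le ha hL
  obtain ⟨c₀, hc₀, hdrift⟩ := exists_mul_sq_saddleDist_le_driftSq ha
  obtain ⟨B₁, hB₁, hincr⟩ := exists_abs_profile_sub_le hA.le he hc₀
  obtain ⟨B₂, hB₂, hsize⟩ := exists_abs_profile_sub_saddle_le hA.le he
  have hB₂c₀ : 0 < B₂ / c₀ := by positivity
  refine ⟨B₁ + B₂ + B₂ / c₀, by positivity, c, hc, δ₀, hδ₀,
    fun s => profile A e s - profile A e (saddle 0), ?_, ?_, ?_, ?_⟩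
  · intro s hs
    calc _ ≤ B₂ * 1 ^ 2 := (hsize s hs 0).trans
          (by gcongr; exacts [saddleDist_nonneg s, saddleDist_le_one hs])
      _ ≤ _ := by linarith
  · intro s hs hcentre
    calc _ ≤ B₂ / c₀ * (c₀ * saddleDist s ^ 2) := (hsize s hs 0).trans_eq (by field_simp)
      _ ≤ (B₁ + B₂ + B₂ / c₀) * driftSq critSlope s := by
        gcongr
        exacts [by linarith, hdrift s hs hcentre]
  · intro s hs hcentre t ht
    rw [sub_sub_sub_cancel_right]
    refine (hincr s hs (hdrift s hs hcentre) t ht).trans ?_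
    gcongr
    linarith
  · intro δ s ι _ w v hstep hδ hδ_le hcentre
    simp only [sub_sub_sub_cancel_right]
    exact hmean hstep hδ hδ_le hcentre

theorem IsProfile.wmean_arsinh_sub_le {a B c K L δ δ₀ : ℝ} {h : (Fin 3 → ℝ) → ℝ}
    (hh : IsProfile a L B c δ₀ h) (hB : 0 < B) (hc : 0 < c) (hBK : 6 * B ≤ K)
    (hcK : 8 * B ^ 2 ≤ c * K) (hδ : 0 < δ) (hδ1 : δ ≤ 1) (hδ_le : δ ≤ δ₀) {s : Fin 3 → ℝ}
    {ι : Type} [Fintype ι] {w : ι → ℝ} {v : ι → Fin 3 → ℝ} (hstep : IsStep L δ s w v)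
    (hcentre : a ≤ centreDist s) :
    wmean w (fun j => Real.arsinh (h (s + δ • v j) / (K * δ)) - Real.arsinh (h s / (K * δ))) ≤
      -(c * δ / (2 * K)) := by
  have hincr (j : ι) :
      |h (s + δ • v j) - h s| ≤ B * (√(driftSq critSlope s) * δ + δ ^ 2) := by
    refine (hh.abs_sub_le s hstep.mem hcentre _ (hstep.mem_add j)).trans ?_
    rw [add_sub_cancel_left]
    gcongr <;> exact hstep.norm_smul_le hδ.le j
  have hdriftSq : driftSq critSlope s ≤ 3 := by
    simpa only [Fintype.card_fin, Nat.cast_ofNat] using driftSq_le_card (β := critSlope) hstep.mem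
  have hmean := wmean_arsinh_div_sub_le hδ hδ1 hB hc (driftSq_nonneg _ s) hdriftSq hBK hcK
    hstep.nonneg hstep.sum_one (hh.wmean_sub_le hstep hδ.le hδ_le hcentre) hincr
    (hh.abs_le_driftSq s hstep.mem hcentre)
  simpa only [add_sub_cancel] using hmean

theorem exists_lyapunov {a L : ℝ} (ha : 0 < a) (hL : 0 < L) :
    ∃ C > 0, ∃ δ₀ > 0, ∀ δ, 0 < δ → δ ≤ δ₀ → ∃ V : (Fin 3 → ℝ) → ℝ,
      (∀ s ∈ stdSimplex ℝ (Fin 3), 0 ≤ V s ∧ V s ≤ C * (1 / δ * Real.log (1 / δ))) ∧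
      ∀ {s : Fin 3 → ℝ} {ι : Type} [Fintype ι] {w : ι → ℝ} {v : ι → Fin 3 → ℝ},
        IsStep L δ s w v → a ≤ centreDist s → wmean w (fun j => V (s + δ • v j)) ≤ V s - 1 := by
  obtain ⟨B, hB, c, hc, δ₀, hδ₀, h, hh⟩ := exists_isProfile ha hL
  obtain ⟨K, hBK, hcK⟩ : ∃ K, 6 * B ≤ K ∧ 8 * B ^ 2 ≤ c * K :=
    ⟨max (6 * B) (8 * B ^ 2 / c), le_max_left _ _, (div_le_iff₀' hc).1 (le_max_right _ _)⟩
  have hK : 0 < K := by linarith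
  refine ⟨8 * K / c, by positivity, min δ₀ (1 / 3), by positivity, fun δ hδ hδ_le =>
    ⟨fun s => 2 * K / (c * δ) * (Real.arsinh (h s / (K * δ)) + 2 * Real.log (1 / δ)),
      fun s hs => ?_, fun {s ι _ w v} hstep hcentre => ?_⟩⟩
  · have harsinh := abs_le.1 <| abs_arsinh_div_le (u := h s) hK
      ((hh.abs_le s hs).trans (by linarith)) hδ (hδ_le.trans (min_le_right _ _))
    refine ⟨mul_nonneg (by positivity) (by linarith), ?_⟩
    calc _ ≤ 2 * K / (c * δ) * (4 * Real.log (1 / δ)) :=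
          mul_le_mul_of_nonneg_left (by linarith) (by positivity)
      _ = _ := by ring
  · have hmean := hh.wmean_arsinh_sub_le hB hc hBK hcK hδ
      (hδ_le.trans ((min_le_right _ _).trans (by norm_num))) (hδ_le.trans (min_le_left _ _))
      hstep hcentre
    have hsplit := wmean_add w
      (fun j => Real.arsinh (h (s + δ • v j) / (K * δ)) - Real.arsinh (h s / (K * δ)))
      fun _ => Real.arsinh (h s / (K * δ)) + 2 * Real.log (1 / δ)
    simp only [← add_assoc, sub_add_cancel] at hsplit
    rw [wmean_const hstep.sum_one] at hsplit
    rw [wmean_mul, hsplit, mul_add, add_comm, sub_eq_add_neg]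
    gcongr
    calc _ ≤ 2 * K / (c * δ) * -(c * δ / (2 * K)) := by gcongr
      _ = -1 := by field_simp

/-! ### The hitting time -/

theorem hammingDist_update_self_lt {ι : Type*} [Fintype ι] [DecidableEq ι] {κ : ι → Type*}
    [∀ i, DecidableEq (κ i)] {σ τ : ∀ i, κ i} {l : ι} (hl : σ l ≠ τ l) :
    hammingDist (Function.update σ l (τ l)) τ < hammingDist σ τ := by
  refine Finset.card_lt_card ((Finset.ssubset_iff_of_subset fun i hi => ?_).2 ⟨l, ?_, ?_⟩)
  · rcases eq_or_ne i l with rfl | hil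
    · simpa using hl
    · simpa [hil] using hi
  · simpa using hl
  · simp

/-- The configurations whose magnetisation lies in the region around the centres which defines
`hitTime`. -/
def central (M : ℕ) : Set (Config M) := {σ | centreDist (magnetisation σ) ≤ rho / 2}

/-- There is a nonnegative function bounded by `C M log M` whose expectation decreases by at least
one in every step of the critical Glauber dynamics from a non-central configuration. -/
def HasLyapunov (M : ℕ) (C : ℝ) : Prop :=
  ∃ V : Config M → ℝ, (∀ σ, 0 ≤ V σ) ∧ (∀ σ, V σ ≤ C * (M * Real.log M)) ∧
    ∀ σ ∉ central M, ∑ τ, glauber M betaCrit σ τ * V τ ≤ V σ - 1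

theorem HasLyapunov.mono {M : ℕ} {C C' : ℝ} (h : HasLyapunov M C) (hC : C ≤ C') :
    HasLyapunov M C' := by
  obtain ⟨V, hV0, hVC, hV⟩ := h
  have := Real.log_natCast_nonneg M
  exact ⟨V, hV0, fun σ => (hVC σ).trans (by gcongr), hV⟩

theorem exists_hasLyapunov_of_nonempty {M : ℕ} (hM : 2 ≤ M) (hne : (central M).Nonempty) :
    ∃ C, HasLyapunov M C := by
  obtain ⟨τ, hτ⟩ := hne
  have hM0 : M ≠ 0 := by omega
  have hMlog : 0 < M * Real.log M :=
    mul_pos (by positivity) (Real.log_pos (by exact_mod_cast hM))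
  have hdescent (σ : Config M) (hσ : σ ∉ central M) :
      ∃ σ', hammingDist σ' τ < hammingDist σ τ ∧
        1 / (M : ℝ) * (1 / 48) ≤ glauber M betaCrit σ σ' := by
    obtain ⟨l, hl⟩ := Function.ne_iff.1 (ne_of_mem_of_not_mem hτ hσ).symm
    refine ⟨_, hammingDist_update_self_lt hl, ?_⟩
    exact (mul_le_mul_of_nonneg_left (le_spinCondProb_betaCrit hM0 σ l _) (by positivity)).trans
      (one_div_mul_spinCondProb_le_glauber ..)
  have hq : 1 / (M : ℝ) * (1 / 48) ≤ 1 := by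
    rw [one_div]
    linarith [Nat.cast_inv_le_one (α := ℝ) M]
  obtain ⟨V, hV0, hV⟩ := exists_unit_drift_of_descent (glauber_nonneg betaCrit)
    (sum_glauber hM0 betaCrit) (fun σ => hammingDist σ τ) (by positivity) hq hdescent
  refine ⟨(∑ σ, V σ) / (M * Real.log M), V, hV0, fun σ => ?_, hV⟩
  rw [div_mul_cancel₀ _ hMlog.ne']
  exact Finset.single_le_sum (fun σ _ => hV0 σ) (Finset.mem_univ σ)

theorem exists_forall_ge_hasLyapunov : ∃ C > 0, ∃ M₀, ∀ M ≥ M₀, HasLyapunov M C := by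
  obtain ⟨L, hL, hstep⟩ := exists_isStep_glauber
  obtain ⟨C, hC, δ₀, hδ₀, hV⟩ := exists_lyapunov (a := rho / 2) (by norm_num [rho]) hL
  obtain ⟨N, hN⟩ := exists_nat_one_div_lt hδ₀
  refine ⟨C, hC, N + 1, fun M hM => ?_⟩
  have hM0 : M ≠ 0 := by omega
  have hδ : 1 / (M : ℝ) ≤ δ₀ := by
    refine le_trans ?_ hN.le
    gcongr
    exact_mod_cast hM
  obtain ⟨V, hVC, hdrift⟩ := hV (1 / M) (by positivity) hδ
  rw [one_div_one_div] at hVC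
  refine ⟨fun σ => V (magnetisation σ),
    fun σ => (hVC _ (magnetisation_mem_stdSimplex hM0 σ)).1,
    fun σ => (hVC _ (magnetisation_mem_stdSimplex hM0 σ)).2, fun σ hσ => ?_⟩
  rw [sum_glauber_eq_wmean]
  simpa only [magnetisation_add_stepIncr] using hdrift (hstep M hM0 σ) (not_le.1 hσ).le

theorem exists_hasLyapunov :
    ∃ C > 0, ∀ M ≥ 2, (central M).Nonempty → HasLyapunov M C := by
  obtain ⟨C, hC, M₀, hlarge⟩ := exists_forall_ge_hasLyapunov
  have hsmall (M : ℕ) : ∃ C', 2 ≤ M → (central M).Nonempty → HasLyapunov M C' := by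
    by_cases h : 2 ≤ M ∧ (central M).Nonempty
    · exact (exists_hasLyapunov_of_nonempty h.1 h.2).imp fun _ hC' _ _ => hC'
    · exact ⟨0, fun hM hne => (h ⟨hM, hne⟩).elim⟩
  choose C' hC' using hsmall
  obtain ⟨B, hB⟩ := ((Finset.range M₀).image C').exists_le
  refine ⟨max C B, lt_max_of_lt_left hC, fun M hM hne => ?_⟩
  rcases le_or_gt M₀ M with hMM₀ | hMM₀
  · exact (hlarge M hMM₀).mono (le_max_left _ _)
  · exact (hC' M hM hne).mono
      ((hB _ (Finset.mem_image_of_mem _ (Finset.mem_range.2 hMM₀))).trans (le_max_right _ _))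

theorem abs_sub_le_sqrt_two_mul_triDist (s t : Fin 3 → ℝ) (k : Fin 3) :
    |s k - t k| ≤ √2 * triDist s t := by
  rw [triDist, ← mul_assoc, mul_one_div_cancel (by positivity), one_mul]
  exact Real.abs_le_sqrt (Finset.single_le_sum (f := fun k => (s k - t k) ^ 2)
    (fun _ _ => sq_nonneg _) (Finset.mem_univ k))

theorem centreDist_le_iff {s : Fin 3 → ℝ} {r : ℝ} :
    centreDist s ≤ r ↔ ∃ i, triDist s (centre i) ≤ r := by
  simp [centreDist, Fin.exists_fin_succ, or_assoc]

theorem one_sixth_le_centre (i : Fin 4) (k : Fin 3) : 1 / 6 ≤ centre i k := by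
  fin_cases i <;> fin_cases k <;> norm_num [centre]

theorem three_le_of_mem_central {M : ℕ} {σ : Config M} (hσ : σ ∈ central M) : 3 ≤ M := by
  obtain ⟨i, hi⟩ := centreDist_le_iff.1 hσ
  have hpos (k : Fin 3) : 0 < magnetisation σ k := by
    have hclose : |magnetisation σ k - centre i k| ≤ 3 / 2 * (rho / 2) :=
      (abs_sub_le_sqrt_two_mul_triDist _ _ k).trans <| mul_le_mul
        Real.sqrt_two_lt_three_halves.le hi (by unfold triDist; positivity) (by norm_num)
    have hrho : 3 / 2 * (rho / 2) < 1 / 6 := by norm_num [rho]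
    linarith [(abs_le.1 hclose).1, one_sixth_le_centre i k]
  have hsurj : Function.Surjective σ := by
    intro k
    by_contra! hk
    simpa [magnetisation, hk] using hpos k
  simpa using Fintype.card_le_of_surjective σ hsurj

theorem lt_centreDist_of_lt_hitTime {S : ℕ → Fin 3 → ℝ} {a : ℝ}
    (ha : (a : EReal) < ((hitTime S : ℕ∞) : EReal)) {k : ℕ} (hk : k ≤ a) :
    rho / 2 < centreDist (S k) := by
  by_contra! hcentral
  have hle : hitTime S ≤ k := iInf₂_le k hcentral
  have hle' : ((hitTime S : ℕ∞) : EReal) ≤ ((k : ℝ) : EReal) :=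
    EReal.coe_ennreal_le_coe_ennreal_iff.2 (ENat.toENNReal_le.2 hle)
  exact (ha.trans_le hle').not_ge (EReal.coe_le_coe hk)

theorem one_le_mul_log {M : ℕ} (hM : 3 ≤ M) : 1 ≤ M * Real.log M := by
  have hM' : (3 : ℝ) ≤ M := by exact_mod_cast hM
  have hlog : 1 ≤ Real.log M := by
    rw [Real.le_log_iff_exp_le (by positivity)]
    linarith [Real.exp_one_lt_three]
  exact one_le_mul_of_one_le_of_one_le (by linarith) hlog

theorem HasLyapunov.measureReal_lt_hitTime_le {M : ℕ} {C : ℝ} (h : HasLyapunov M C) (hM : 3 ≤ M)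
    {Ω : Type*} [MeasurableSpace Ω] {μ : Measure Ω} [IsProbabilityMeasure μ]
    {σ : ℕ → Ω → Config M} (hσ : IsMarkovChain μ (glauber M betaCrit) σ) {r : ℝ} (hr : 0 ≤ r) :
    μ.real {ω | ((r * ((Real.exp 1 * C + 1) * M * Real.log M) : ℝ) : EReal) <
      ((hitTime fun k => magnetisation (σ k ω) : ℕ∞) : EReal)} ≤ Real.exp (-(⌊r⌋ : ℝ)) := by
  obtain ⟨V, hV0, hVC, hV⟩ := h
  have hC : 0 ≤ C * (M * Real.log M) := (hV0 0).trans (hVC 0)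
  set T := ⌈Real.exp 1 * (C * (M * Real.log M))⌉₊
  have hT_le : T ≤ (Real.exp 1 * C + 1) * M * Real.log M := by
    linarith [Nat.ceil_lt_add_one (mul_nonneg (Real.exp_pos 1).le hC), one_le_mul_log hM]
  have htime : (⌊r⌋₊ * T : ℕ) ≤ r * ((Real.exp 1 * C + 1) * M * Real.log M) := by
    rw [Nat.cast_mul]
    exact mul_le_mul (Nat.floor_le hr) hT_le (Nat.cast_nonneg _) hr
  calc _ ≤ μ.real {ω | ∀ k ≤ ⌊r⌋₊ * T, σ k ω ∉ central M} := measureReal_mono fun ω hω k hk =>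
        (lt_centreDist_of_lt_hitTime hω ((Nat.cast_le.2 hk).trans htime)).not_ge
    _ ≤ Real.exp (-⌊r⌋₊) := hσ.measureReal_avoid_le_exp hV0 hV hVC (Nat.le_ceil _) _
    _ = Real.exp (-⌊r⌋) := by rw [natCast_floor_eq_intCast_floor hr]

end MeanFieldPotts

end

theorem mainTheorem7 :
    ∃ C : ℝ, 0 < C ∧
      ∀ (M : ℕ),
        (∃ z ∈ MeanFieldPotts.magStates M,
          MeanFieldPotts.centreDist z ≤ MeanFieldPotts.rho / 2) →
        ∀ {Ω : Type*} [MeasurableSpace Ω] (μ : Measure Ω) [IsProbabilityMeasure μ]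
          (σ : ℕ → Ω → MeanFieldPotts.Config M),
          MeanFieldPotts.IsMarkovChain μ
            (MeanFieldPotts.glauber M MeanFieldPotts.betaCrit) σ →
          ∀ S : ℕ → Ω → Fin 3 → ℝ,
            (∀ k ω, S k ω = MeanFieldPotts.magnetisation (σ k ω)) →
            ∀ s ∈ MeanFieldPotts.magStates M,
              μ {ω | S 0 ω = s} ≠ 0 →
              ∀ r : ℝ, 0 ≤ r →
                (μ[|{ω | S 0 ω = s}]).real
                    {ω | ((r * (C * M * Real.log M) : ℝ) : EReal) <
                      ((MeanFieldPotts.hitTime fun k => S k ω : ℕ∞) : EReal)} ≤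
                  Real.exp (-(⌊r⌋ : ℝ)) := by
  obtain ⟨C, hC, hlyapunov⟩ := MeanFieldPotts.exists_hasLyapunov
  refine ⟨Real.exp 1 * C + 1, by positivity, ?_⟩
  rintro M ⟨_, ⟨τ, rfl⟩, hτ⟩ Ω _ μ _ σ hσ S hS s - hs r hr
  obtain rfl : S = fun k ω => MeanFieldPotts.magnetisation (σ k ω) := funext₂ hS
  have hM : 3 ≤ M := MeanFieldPotts.three_le_of_mem_central hτ
  have : IsProbabilityMeasure (μ[|σ 0 ⁻¹' (MeanFieldPotts.magnetisation ⁻¹' {s})]) :=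
    cond_isProbabilityMeasure hs
  have hσ_cond := hσ.cond_initial (I := MeanFieldPotts.magnetisation ⁻¹' {s})
    (Set.toFinite _).measurableSet
  exact (hlyapunov M (by omega) ⟨τ, hτ⟩).measureReal_lt_hitTime_le hM hσ_cond hr
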